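/- **Algebras.** A *skew lattice* is a set with two idempotent associative operations $\wedge,\vee$ satisfying $x\wedge(x\vee y)=x=(y\vee x)\wedge x$ and $x\vee(x\wedge y)=x=(y\wedge x)\vee x$. Its natural partial order is $x\le y\iff x\wedge y=y\wedge x=x$, and its natural preorder is $x\preceq y\iff x\wedge y\wedge x=x$. A *skew Boolean algebra with intersections* is a skew lattice $A$ that satisfies $x\wedge(y\vee z)=(x\wedge y)\vee(x\wedge z)$ and $(y\vee z)\wedge x=(y\wedge x)\vee(z\wedge x)$, has an element $0$ neutral for $\vee$ and an operation $\setminus$ with $(x\setminus y)\wedge(x\wedge y\wedge x)=0$ and $(x\setminus y)\vee(x\wedge y\wedge x)=x$, and in which any two elements $x,y$ have a greatest lower bound $x\cap y$ with respect to $\le$. It is *right-handed* if $x\wedge y\wedge x=y\wedge x$ for all $x,y$. Homomorphisms preserve $0,\wedge,\vee,\setminus,\cap$. **Spaces.** A *Boolean space* is a zero-dimensional locally compact Hausdorff space. A *skew Boolean space* is a surjective étale map (local homeomorphism) $p:E\to B$ between Boolean spaces. A morphism from $p:E\to B$ to $p':E'\to B'$ is a pair $(g,h)$ of continuous partial maps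 $g:E\rightharpoonup E'$, $h:B\rightharpoonup B'$ with open domains, which are proper (the preimage of every compact set is compact), such that - for every $y\in\operatorname{dom} g$, $p(y)\in\operatorname{dom} h$ and $h(p(y))=p'(g(y))$; - for every $x\in\operatorname{dom}h$, $g$ maps $p^{-1}(x)\cap\operatorname{dom}g$ bijectively onto $p'^{-1}(h(x))$. Morphisms are composed componentwise as partial maps. **Skew spectrum.** An ideal of $A$ is a subset containing $0$ that is closed under $\vee$ and a lower set for $\preceq$; an ideal $P\neq A$ is prime if $a\wedge b\in P$ implies $a\in P$ or $b\in P$. Let $\theta_P$ be the least congruence on $A$ (for all the operations) whose zero-class contains $P$. The spectrum $\operatorname{St}(A)$ is the set of prime ideals, with basic open sets $N_a=\{P\mid a\notin P\}$, $a\in A$. The skew spectrum $\operatorname{Sk}(A)$ is the set of pairs $(P,[t]_{\theta_P})$ with $P$ a prime ideal and $t\notin P$, with basic open sets $M_a=\{(P,[a]_{\theta_P})\mid a\notin P\}$. Let $q_A:\operatorname{Sk}(A)\to\operatorname{St}(A)$, $q_A(P,[t]_{\theta_P})=P$. A homomorphism $f:A\to A'$ induces the partial map $\operatorname{St}(A')\rightharpoonup\operatorname{St}(A)$,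 $P\mapsto f^{-1}(P)$, defined when $f^{-1}(P)\ne A$, and the partial map $\operatorname{Sk}(A')\rightharpoonup\operatorname{Sk}(A)$, $(P,[f(a)]_{\theta_P})\mapsto(f^{-1}(P),[a]_{\theta_{f^{-1}(P)}})$, defined exactly on the points of the form $(P,[f(a)]_{\theta_P})$ with $f(a)\notin P$. **Copen sections.** For a skew Boolean space $p:E\to B$, let $A_p$ be the set of compact open $S\subseteq E$ on which $p$ is injective, and let $\sigma_p(S)=p^{-1}(p(S))$. It is a right-handed skew Boolean algebra with intersections for the operations $0=\emptyset$, $S\wedge R=\sigma_p(S)\cap R$, $S\vee R=S\cup(R\setminus\sigma_p(S))$, $S\setminus R=S\setminus\sigma_p(R)$ (set-theoretic difference on the right-hand sides), and set-theoretic intersection. A morphism $(g,h):p\to p'$ induces the homomorphism $A_{p'}\to A_p$, $S\mapsto g^{-1}(S)$. **Theorem.** The category of right-handed skew Boolean algebras with intersections and homomorphisms is dually equivalent to the category of skew Boolean spaces. More precisely, the assignments $A\mapsto q_A$ and $f\mapsto$ (the two partial maps induced by $f$) are well defined and form a contravariant functor from right-handed skew Boolean algebras with intersections to skew Boolean spaces;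 and this functor, together with the contravariant functor $p\mapsto A_p$, $(g,h)\mapsto g^{-1}$, constitutes a dual equivalence of the two categories. -/

import Mathlib

open CategoryTheory Opposite

universe u

/-! ### Skew Boolean algebras with intersections -/

/-- A skew lattice: the meet is written `⊓` and the join `⊔`; neither needs to be commutative. -/
class SkewLattice (A : Type u) extends Min A, Max A where
  inf_idem : ∀ x : A, x ⊓ x = x
  sup_idem : ∀ x : A, x ⊔ x = x
  inf_assoc : ∀ x y z : A, x ⊓ y ⊓ z = x ⊓ (y ⊓ z)
  sup_assoc : ∀ x y z : A, x ⊔ y ⊔ z = x ⊔ (y ⊔ z)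
  inf_sup_self : ∀ x y : A, x ⊓ (x ⊔ y) = x
  sup_inf_self' : ∀ x y : A, (y ⊔ x) ⊓ x = x
  sup_inf_self : ∀ x y : A, x ⊔ (x ⊓ y) = x
  inf_sup_self' : ∀ x y : A, (y ⊓ x) ⊔ x = x

/-- The natural partial order `x ≤ y` of a skew lattice. -/
def NatLE {A : Type u} [SkewLattice A] (x y : A) : Prop := x ⊓ y = x ∧ y ⊓ x = x

/-- The natural preorder `x ⪯ y` of a skew lattice. -/
def NatPreLE {A : Type u} [SkewLattice A] (x y : A) : Prop := x ⊓ y ⊓ x = x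

/-- A skew Boolean algebra: a meet-distributive skew lattice with a zero and a relative
complement. -/
class SkewBooleanAlgebra (A : Type u) extends SkewLattice A, Zero A, SDiff A where
  inf_sup_left : ∀ x y z : A, x ⊓ (y ⊔ z) = (x ⊓ y) ⊔ (x ⊓ z)
  inf_sup_right : ∀ x y z : A, (y ⊔ z) ⊓ x = (y ⊓ x) ⊔ (z ⊓ x)
  zero_sup : ∀ x : A, 0 ⊔ x = x
  sup_zero : ∀ x : A, x ⊔ 0 = x
  sdiff_inf : ∀ x y : A, (x \ y) ⊓ (x ⊓ y ⊓ x) = 0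
  sdiff_sup : ∀ x y : A, (x \ y) ⊔ (x ⊓ y ⊓ x) = x

/-- A skew Boolean algebra with intersections: any two elements `x`, `y` have a greatest lower
bound `inter x y` with respect to the natural partial order. -/
class SkewBooleanInterAlgebra (A : Type u) extends SkewBooleanAlgebra A where
  inter : A → A → A
  inter_le_left : ∀ x y : A, NatLE (inter x y) x
  inter_le_right : ∀ x y : A, NatLE (inter x y) y
  le_inter : ∀ x y z : A, NatLE z x → NatLE z y → NatLE z (inter x y)

/-- A skew lattice is right-handed when `x ∧ y ∧ x = y ∧ x` holds. -/
def IsRightHanded (A : Type u) [SkewLattice A] : Prop := ∀ x y : A, x ⊓ y ⊓ x = y ⊓ x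

/-- Homomorphisms preserve all the operations. -/
@[ext]
structure SkewAlgHom (A A' : Type u) [SkewBooleanInterAlgebra A] [SkewBooleanInterAlgebra A'] where
  toFun : A → A'
  map_zero : toFun 0 = 0
  map_inf : ∀ x y, toFun (x ⊓ y) = toFun x ⊓ toFun y
  map_sup : ∀ x y, toFun (x ⊔ y) = toFun x ⊔ toFun y
  map_sdiff : ∀ x y, toFun (x \ y) = toFun x \ toFun y
  map_inter : ∀ x y, toFun (SkewBooleanInterAlgebra.inter x y) =
    SkewBooleanInterAlgebra.inter (toFun x) (toFun y)

instance {A A' : Type u} [SkewBooleanInterAlgebra A] [SkewBooleanInterAlgebra A'] :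
    CoeFun (SkewAlgHom A A') (fun _ => A → A') := ⟨SkewAlgHom.toFun⟩

/-- Right-handed skew Boolean algebras with intersections. -/
structure RightSkewAlg where
  carrier : Type u
  [str : SkewBooleanInterAlgebra carrier]
  rightHanded : IsRightHanded carrier

instance : CoeSort RightSkewAlg.{u} (Type u) := ⟨RightSkewAlg.carrier⟩

instance (A : RightSkewAlg.{u}) : SkewBooleanInterAlgebra A := A.str

/-- The category of right-handed skew Boolean algebras with intersections and all
homomorphisms. -/
instance : Category RightSkewAlg.{u} where
  Hom A A' := SkewAlgHom A A'
  id A := ⟨fun x => x, rfl, fun _ _ => rfl, fun _ _ => rfl, fun _ _ => rfl, fun _ _ => rfl⟩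
  comp f g := ⟨fun x => g.toFun (f.toFun x),
    by rw [f.map_zero, g.map_zero],
    fun x y => by rw [f.map_inf, g.map_inf],
    fun x y => by rw [f.map_sup, g.map_sup],
    fun x y => by rw [f.map_sdiff, g.map_sdiff],
    fun x y => by rw [f.map_inter, g.map_inter]⟩

/-! ### Skew Boolean spaces -/

/-- A Boolean space: a zero-dimensional locally compact Hausdorff space. -/
structure IsBooleanSpace (X : Type u) [TopologicalSpace X] : Prop where
  t2 : T2Space X
  locallyCompact : LocallyCompactSpace X
  zeroDimensional : TopologicalSpace.IsTopologicalBasis {s : Set X | IsClopen s}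

/-- A surjective étale map between Boolean spaces. -/
structure IsSkewBoolean {E B : Type u} [TopologicalSpace E] [TopologicalSpace B]
    (p : E → B) : Prop where
  total : IsBooleanSpace E
  base : IsBooleanSpace B
  surjective : Function.Surjective p
  etale : IsLocalHomeomorph p

/-- A proper continuous partial map with open domain of definition. -/
structure IsProperPartial {X Y : Type u} [TopologicalSpace X] [TopologicalSpace Y]
    (f : X →. Y) : Prop where
  isOpen_dom : IsOpen f.Dom
  continuous : Continuous f.asSubtype
  isCompact_preimage : ∀ K : Set Y, IsCompact K → IsCompact (f.preimage K)

/-- `(g, h)` is a morphism from `p` to `p'`. The square commutes: where `g` is defined at `y`, `h`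
is defined at `p y`, with value `p' (g y)`. Moreover `g` maps the part of the fiber over `x` on
which it is defined bijectively onto the fiber over `h x`, for every `x` in the domain of `h`. -/
structure IsSkewBooleanMorphism {E B E' B' : Type u}
    [TopologicalSpace E] [TopologicalSpace B] [TopologicalSpace E'] [TopologicalSpace B']
    (p : E → B) (p' : E' → B') (g : E →. E') (h : B →. B') : Prop where
  top : IsProperPartial g
  bot : IsProperPartial h
  comm : ∀ y : E, ∀ y' ∈ g y, p' y' ∈ h (p y)
  fiber : ∀ x : B, ∀ x' ∈ h x, ∀ y' : E', p' y' = x' → ∃! y : E, p y = x ∧ y' ∈ g y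

/-- Skew Boolean spaces. -/
structure SkewBooleanSpace where
  Total : Type u
  Base : Type u
  [topTotal : TopologicalSpace Total]
  [topBase : TopologicalSpace Base]
  proj : Total → Base
  isSkewBoolean : IsSkewBoolean proj

attribute [instance] SkewBooleanSpace.topTotal SkewBooleanSpace.topBase

/-- Morphisms of skew Boolean spaces. -/
@[ext]
structure SkewBooleanSpace.Hom (X Y : SkewBooleanSpace.{u}) where
  top : X.Total →. Y.Total
  bot : X.Base →. Y.Base
  isMorphism : IsSkewBooleanMorphism X.proj Y.proj top bot

theorem IsProperPartial.isOpen_preimage {X Y : Type u} [TopologicalSpace X] [TopologicalSpace Y]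
    {f : X →. Y} (hf : IsProperPartial f) {s : Set Y} (hs : IsOpen s) :
    IsOpen (f.preimage s) := by
  have h1 := hf.isOpen_dom.isOpenMap_subtype_val _ (hs.preimage hf.continuous)
  convert h1 using 1
  ext x
  simp only [PFun.mem_preimage, Set.mem_image, Set.mem_preimage, Subtype.exists]
  constructor
  · rintro ⟨y, hy, hxy⟩
    obtain ⟨hd, rfl⟩ := hxy
    exact ⟨x, hd, hy, rfl⟩
  · rintro ⟨x, hd, hy, rfl⟩
    exact ⟨_, hy, hd, rfl⟩

theorem isProperPartial_of_preimage {X Y : Type u} [TopologicalSpace X] [TopologicalSpace Y]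
    {f : X →. Y} (ho : ∀ s, IsOpen s → IsOpen (f.preimage s))
    (hc : ∀ K, IsCompact K → IsCompact (f.preimage K)) : IsProperPartial f := by
  refine ⟨?_, ?_, hc⟩
  · have := ho _ isOpen_univ
    rwa [PFun.preimage_univ] at this
  · refine ⟨fun s hs => ?_⟩
    convert (ho s hs).preimage continuous_subtype_val using 1
    ext ⟨x, hx⟩
    simp only [PFun.mem_preimage, Set.mem_preimage]
    constructor
    · intro h
      exact ⟨_, h, hx, rfl⟩
    · rintro ⟨y, hy, hd, rfl⟩
      exact hy

theorem IsProperPartial.comp {X Y Z : Type u} [TopologicalSpace X] [TopologicalSpace Y]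
    [TopologicalSpace Z] {f : X →. Y} {g : Y →. Z} (hf : IsProperPartial f)
    (hg : IsProperPartial g) : IsProperPartial (g.comp f) := by
  apply isProperPartial_of_preimage
  · intro s hs
    rw [PFun.preimage_comp]
    exact hf.isOpen_preimage (hg.isOpen_preimage hs)
  · intro K hK
    rw [PFun.preimage_comp]
    exact hf.isCompact_preimage _ (hg.isCompact_preimage _ hK)

theorem preimage_pfun_id {X : Type u} (s : Set X) : (PFun.id X).preimage s = s := by
  ext x
  constructor
  · rintro ⟨y, hy, hxy⟩
    rwa [← Part.mem_some_iff.1 hxy]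
  · exact fun hx => ⟨x, hx, Part.mem_some x⟩

theorem mem_pfun_comp {X Y Z : Type u} {f : X →. Y} {g : Y →. Z} {x : X} {z : Z} :
    z ∈ g.comp f x ↔ ∃ y, y ∈ f x ∧ z ∈ g y := by
  rw [PFun.comp_apply]
  exact Part.mem_bind_iff

theorem isProperPartial_id (X : Type u) [TopologicalSpace X] : IsProperPartial (PFun.id X) := by
  apply isProperPartial_of_preimage
  · intro s hs
    rwa [preimage_pfun_id]
  · intro s hs
    rwa [preimage_pfun_id]

/-- The category of skew Boolean spaces; morphisms are composed as partial maps. -/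
instance : Category SkewBooleanSpace.{u} where
  Hom X Y := SkewBooleanSpace.Hom X Y
  id X := ⟨PFun.id _, PFun.id _, isProperPartial_id _, isProperPartial_id _, by
      rintro y y' h
      obtain rfl : y' = y := by simpa [PFun.id] using h
      simp [PFun.id], by
      rintro x x' h y' hy
      obtain rfl : x' = x := by simpa [PFun.id] using h
      exact ⟨y', ⟨hy, by simp [PFun.id]⟩, fun z hz => by simpa [PFun.id, eq_comm] using hz.2⟩⟩
  comp {X Y Z} f g := ⟨g.top.comp f.top, g.bot.comp f.bot,
    f.isMorphism.top.comp g.isMorphism.top, f.isMorphism.bot.comp g.isMorphism.bot, by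
      intro y y'' h
      obtain ⟨y', h1, h2⟩ : ∃ y', y' ∈ f.top y ∧ y'' ∈ g.top y' := mem_pfun_comp.1 h
      exact mem_pfun_comp.2 ⟨_, f.isMorphism.comm _ _ h1, g.isMorphism.comm _ _ h2⟩, by
      intro x x'' h y'' hy
      obtain ⟨x', h1, h2⟩ : ∃ x', x' ∈ f.bot x ∧ x'' ∈ g.bot x' := mem_pfun_comp.1 h
      obtain ⟨y', ⟨hy', hg⟩, hu'⟩ := g.isMorphism.fiber _ _ h2 _ hy
      obtain ⟨y, ⟨hy0, hf⟩, hu⟩ := f.isMorphism.fiber _ _ h1 _ hy'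
      refine ⟨y, ⟨hy0, ?_⟩, ?_⟩
      · exact mem_pfun_comp.2 ⟨y', hf, hg⟩
      · rintro z ⟨hz, hz2⟩
        obtain ⟨z', h3, h4⟩ : ∃ z', z' ∈ f.top z ∧ y'' ∈ g.top z' :=
          mem_pfun_comp.1 hz2
        have h5 := f.isMorphism.comm _ _ h3
        rw [hz] at h5
        obtain rfl : z' = y' := hu' z' ⟨Part.mem_unique h5 h1, h4⟩
        exact hu z ⟨hz, h3⟩⟩
  id_comp f := by
    apply SkewBooleanSpace.Hom.ext
    · exact PFun.comp_id _
    · exact PFun.comp_id _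
  comp_id f := by
    apply SkewBooleanSpace.Hom.ext
    · exact PFun.id_comp _
    · exact PFun.id_comp _
  assoc f g h := by
    apply SkewBooleanSpace.Hom.ext
    · exact (PFun.comp_assoc _ _ _).symm
    · exact (PFun.comp_assoc _ _ _).symm

/-! ### From spaces to algebras: copen sections -/

/-- A copen section of `p`, viewed as a compact open subset of the total space on which `p` is
injective. -/
@[ext]
structure CopenSection (X : SkewBooleanSpace.{u}) where
  carrier : Set X.Total
  isOpen : IsOpen carrier
  isCompact : IsCompact carrier
  injOn : Set.InjOn X.proj carrier

/-- The saturation `p⁻¹(p(S))`. -/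
def SkewBooleanSpace.saturation (X : SkewBooleanSpace.{u}) (S : Set X.Total) : Set X.Total :=
  X.proj ⁻¹' (X.proj '' S)

theorem SkewBooleanSpace.mem_saturation (X : SkewBooleanSpace.{u}) (S : Set X.Total)
    (y : X.Total) : y ∈ X.saturation S ↔ ∃ s ∈ S, X.proj s = X.proj y := Iff.rfl

namespace CopenSection

variable {X : SkewBooleanSpace.{u}}

theorem isClopen_saturation (S : CopenSection X) : IsClopen (X.saturation S.carrier) := by
  have hc := X.isSkewBoolean.etale.continuous
  have := X.isSkewBoolean.base.t2
  exact ⟨(S.isCompact.image hc).isClosed.preimage hc,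
    (X.isSkewBoolean.etale.isOpenMap _ S.isOpen).preimage hc⟩

theorem isClosed (S : CopenSection X) : IsClosed S.carrier :=
  have := X.isSkewBoolean.total.t2
  S.isCompact.isClosed

instance : Zero (CopenSection X) := ⟨⟨∅, isOpen_empty, isCompact_empty, Set.injOn_empty _⟩⟩

instance : Min (CopenSection X) := ⟨fun S R => ⟨X.saturation S.carrier ∩ R.carrier,
  S.isClopen_saturation.isOpen.inter R.isOpen, R.isCompact.inter_left S.isClopen_saturation.isClosed,
  R.injOn.mono Set.inter_subset_right⟩⟩

instance : Max (CopenSection X) := ⟨fun S R => ⟨S.carrier ∪ (R.carrier \ X.saturation S.carrier),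
  S.isOpen.union (R.isOpen.sdiff S.isClopen_saturation.isClosed),
  S.isCompact.union (R.isCompact.diff S.isClopen_saturation.isOpen), by
    rintro a (ha | ha) b (hb | hb) hab
    · exact S.injOn ha hb hab
    · exact (hb.2 ⟨a, ha, hab⟩).elim
    · exact (ha.2 ⟨b, hb, hab.symm⟩).elim
    · exact R.injOn ha.1 hb.1 hab⟩⟩

instance : SDiff (CopenSection X) := ⟨fun S R => ⟨S.carrier \ X.saturation R.carrier,
  S.isOpen.sdiff R.isClopen_saturation.isClosed,
  S.isCompact.diff R.isClopen_saturation.isOpen, S.injOn.mono Set.sdiff_subset⟩⟩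

/-- The intersection of two copen sections. -/
def inter (S R : CopenSection X) : CopenSection X :=
  ⟨S.carrier ∩ R.carrier, S.isOpen.inter R.isOpen, S.isCompact.inter_right R.isClosed,
    S.injOn.mono Set.inter_subset_left⟩

theorem carrier_zero : (0 : CopenSection X).carrier = ∅ := rfl

theorem carrier_inf (S R : CopenSection X) :
    (S ⊓ R).carrier = X.saturation S.carrier ∩ R.carrier := rfl

theorem carrier_sup (S R : CopenSection X) :
    (S ⊔ R).carrier = S.carrier ∪ (R.carrier \ X.saturation S.carrier) := rfl

theorem carrier_sdiff (S R : CopenSection X) :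
    (S \ R).carrier = S.carrier \ X.saturation R.carrier := rfl

theorem carrier_inter (S R : CopenSection X) :
    (inter S R).carrier = S.carrier ∩ R.carrier := rfl

/-- The base points covered by a copen section. -/
def support (S : CopenSection X) : Set X.Base := X.proj '' S.carrier

theorem mem_support_of_mem {S : CopenSection X} {y : X.Total} (h : y ∈ S.carrier) :
    X.proj y ∈ S.support := ⟨y, h, rfl⟩

theorem mem_inf {S R : CopenSection X} {y : X.Total} :
    y ∈ (S ⊓ R).carrier ↔ X.proj y ∈ S.support ∧ y ∈ R.carrier := Iff.rfl

theorem mem_sup {S R : CopenSection X} {y : X.Total} :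
    y ∈ (S ⊔ R).carrier ↔ y ∈ S.carrier ∨ (y ∈ R.carrier ∧ X.proj y ∉ S.support) := Iff.rfl

theorem mem_sdiff {S R : CopenSection X} {y : X.Total} :
    y ∈ (S \ R).carrier ↔ y ∈ S.carrier ∧ X.proj y ∉ R.support := Iff.rfl

theorem mem_inter {S R : CopenSection X} {y : X.Total} :
    y ∈ (inter S R).carrier ↔ y ∈ S.carrier ∧ y ∈ R.carrier := Iff.rfl

theorem notMem_zero {y : X.Total} : ¬ y ∈ (0 : CopenSection X).carrier := fun h => h

theorem support_inf {S R : CopenSection X} {x : X.Base} :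
    x ∈ (S ⊓ R).support ↔ x ∈ S.support ∧ x ∈ R.support := by
  constructor
  · rintro ⟨y, hy, rfl⟩
    exact ⟨hy.1, mem_support_of_mem hy.2⟩
  · rintro ⟨hS, y, hy, rfl⟩
    exact ⟨y, ⟨hS, hy⟩, rfl⟩

theorem support_sup {S R : CopenSection X} {x : X.Base} :
    x ∈ (S ⊔ R).support ↔ x ∈ S.support ∨ x ∈ R.support := by
  constructor
  · rintro ⟨y, hy | hy, rfl⟩
    · exact Or.inl (mem_support_of_mem hy)
    · exact Or.inr (mem_support_of_mem hy.1)
  · intro h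
    by_cases hS : x ∈ S.support
    · obtain ⟨y, hy, rfl⟩ := hS
      exact ⟨y, Or.inl hy, rfl⟩
    · obtain ⟨y, hy, rfl⟩ := h.resolve_left hS
      exact ⟨y, Or.inr ⟨hy, hS⟩, rfl⟩

theorem support_sdiff {S R : CopenSection X} {x : X.Base} :
    x ∈ (S \ R).support ↔ x ∈ S.support ∧ x ∉ R.support := by
  constructor
  · rintro ⟨y, hy, rfl⟩
    exact ⟨mem_support_of_mem hy.1, hy.2⟩
  · rintro ⟨⟨y, hy, rfl⟩, hR⟩
    exact ⟨y, ⟨hy, hR⟩, rfl⟩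

theorem ext_mem {S R : CopenSection X} (h : ∀ y, y ∈ S.carrier ↔ y ∈ R.carrier) : S = R :=
  CopenSection.ext (Set.ext h)

/-- The skew lattice of copen sections. -/
instance : SkewLattice (CopenSection X) where
  inf_idem S := ext_mem fun y => by
    have := @mem_support_of_mem X S y
    simp only [mem_inf]; tauto
  sup_idem S := ext_mem fun y => by
    have := @mem_support_of_mem X S y
    simp only [mem_sup]; tauto
  inf_assoc S R T := ext_mem fun y => by simp only [mem_inf, support_inf]; tauto
  sup_assoc S R T := ext_mem fun y => by simp only [mem_sup, support_sup]; tauto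
  inf_sup_self S R := ext_mem fun y => by
    have := @mem_support_of_mem X S y
    simp only [mem_inf, mem_sup]; tauto
  sup_inf_self' S R := ext_mem fun y => by
    have := @mem_support_of_mem X S y
    simp only [mem_inf, support_sup]; tauto
  sup_inf_self S R := ext_mem fun y => by
    simp only [mem_inf, mem_sup]; tauto
  inf_sup_self' S R := ext_mem fun y => by
    have := @mem_support_of_mem X S y
    simp only [mem_inf, mem_sup, support_inf]; tauto

theorem natLE_iff {S R : CopenSection X} : NatLE S R ↔ S.carrier ⊆ R.carrier := by
  constructor
  · rintro ⟨h, -⟩ y hy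
    rw [← h] at hy
    exact hy.2
  · intro h
    refine ⟨ext_mem fun y => ⟨?_, fun hy => ⟨mem_support_of_mem hy, h hy⟩⟩,
      ext_mem fun y => ⟨fun hy => hy.2, fun hy => ⟨mem_support_of_mem (h hy), hy⟩⟩⟩
    rintro ⟨⟨s, hs, hsy⟩, hy⟩
    obtain rfl := R.injOn (h hs) hy hsy
    exact hs

/-- The skew algebra of copen sections. -/
instance : SkewBooleanInterAlgebra (CopenSection X) where
  inf_sup_left S R T := ext_mem fun y => by
    simp only [mem_inf, mem_sup, support_inf]; tauto
  inf_sup_right S R T := ext_mem fun y => by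
    simp only [mem_inf, mem_sup, support_inf, support_sup]; tauto
  zero_sup S := ext_mem fun y => by
    simp only [mem_sup, support, carrier_zero, Set.image_empty]; simp
  sup_zero S := ext_mem fun y => by
    simp only [mem_sup, carrier_zero]; simp
  sdiff_inf S R := ext_mem fun y => by
    simp only [mem_inf, support_sdiff, support_inf, carrier_zero]; simp; tauto
  sdiff_sup S R := ext_mem fun y => by
    have := @mem_support_of_mem X S y
    simp only [mem_inf, mem_sup, mem_sdiff, support_sdiff, support_inf]; tauto
  inter := inter
  inter_le_left S R := natLE_iff.2 fun _ h => h.1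
  inter_le_right S R := natLE_iff.2 fun _ h => h.2
  le_inter S R T h1 h2 := natLE_iff.2 fun _ h => ⟨natLE_iff.1 h1 h, natLE_iff.1 h2 h⟩

theorem isRightHanded : IsRightHanded (CopenSection X) := fun S R => ext_mem fun y => by
  have := @mem_support_of_mem X S y
  simp only [mem_inf, support_inf]; tauto

variable {Y : SkewBooleanSpace.{u}}

/-- The preimage of a copen section under (the top component of) a morphism. -/
def comap (f : X ⟶ Y) (S : CopenSection Y) : CopenSection X where
  carrier := f.top.preimage S.carrier
  isOpen := f.isMorphism.top.isOpen_preimage S.isOpen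
  isCompact := f.isMorphism.top.isCompact_preimage _ S.isCompact
  injOn := by
    rintro a ⟨a', ha', ha⟩ b ⟨b', hb', hb⟩ hab
    have h1 := f.isMorphism.comm _ _ ha
    have h2 := f.isMorphism.comm _ _ hb
    rw [← hab] at h2
    have h3 : a' = b' := S.injOn ha' hb' (Part.mem_unique h1 h2)
    subst h3
    exact (f.isMorphism.fiber _ _ h1 a' rfl).unique ⟨rfl, ha⟩ ⟨hab.symm, hb⟩

theorem mem_comap {f : X ⟶ Y} {S : CopenSection Y} {y : X.Total} :
    y ∈ (comap f S).carrier ↔ ∃ y' ∈ S.carrier, y' ∈ f.top y := Iff.rfl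

theorem mem_comap_iff {f : X ⟶ Y} {S : CopenSection Y} {y : X.Total} {y' : Y.Total}
    (h : y' ∈ f.top y) : y ∈ (comap f S).carrier ↔ y' ∈ S.carrier := by
  constructor
  · rintro ⟨z, hz, hz2⟩
    rwa [Part.mem_unique h hz2]
  · exact fun hy => ⟨y', hy, h⟩

theorem support_comap {f : X ⟶ Y} {S : CopenSection Y} {y : X.Total} {y' : Y.Total}
    (h : y' ∈ f.top y) : X.proj y ∈ (comap f S).support ↔ Y.proj y' ∈ S.support := by
  have h0 := f.isMorphism.comm _ _ h
  constructor
  · rintro ⟨z, ⟨z', hz', hz⟩, hzy⟩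
    have h1 := f.isMorphism.comm _ _ hz
    rw [hzy] at h1
    exact ⟨z', hz', Part.mem_unique h1 h0⟩
  · rintro ⟨z', hz', hzy⟩
    obtain ⟨z, ⟨hz, hz2⟩, -⟩ := f.isMorphism.fiber _ _ h0 z' hzy
    exact ⟨z, ⟨z', hz', hz2⟩, hz⟩

theorem ext_of_comap {f : X ⟶ Y} {S T : CopenSection X}
    (hS : S.carrier ⊆ f.top.Dom) (hT : T.carrier ⊆ f.top.Dom)
    (h : ∀ y y', y' ∈ f.top y → (y ∈ S.carrier ↔ y ∈ T.carrier)) : S = T :=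
  ext_mem fun y =>
    ⟨fun hy => (h y _ (Part.get_mem (hS hy))).1 hy, fun hy => (h y _ (Part.get_mem (hT hy))).2 hy⟩

theorem comap_subset_dom (f : X ⟶ Y) (S : CopenSection Y) : (comap f S).carrier ⊆ f.top.Dom := by
  rintro y ⟨y', -, h⟩
  exact Part.dom_iff_mem.2 ⟨y', h⟩

/-- The homomorphism of algebras of copen sections induced by a morphism. -/
def comapHom (f : X ⟶ Y) : SkewAlgHom (CopenSection Y) (CopenSection X) where
  toFun := comap f
  map_zero := ext_mem fun y => by
    rw [mem_comap, carrier_zero, carrier_zero]; simp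
  map_inf S R := ext_of_comap (f := f) (comap_subset_dom f _)
    (fun _ hy => comap_subset_dom f R hy.2) fun y y' h => by
      simp only [mem_inf, mem_comap_iff h, support_comap h]
  map_sup S R := ext_of_comap (f := f) (comap_subset_dom f _)
    (fun _ hy => hy.elim (fun hy => comap_subset_dom f S hy)
      fun hy => comap_subset_dom f R hy.1) fun y y' h => by
      simp only [mem_sup, mem_comap_iff h, support_comap h]
  map_sdiff S R := ext_of_comap (f := f) (comap_subset_dom f _)
    (fun _ hy => comap_subset_dom f S hy.1) fun y y' h => by
      simp only [mem_sdiff, mem_comap_iff h, support_comap h]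
  map_inter S R := ext_of_comap (f := f) (comap_subset_dom f _)
    (fun _ hy => comap_subset_dom f S hy.1) fun y y' h => by
      change _ ↔ y ∈ (inter (comap f S) (comap f R)).carrier
      rw [mem_inter, mem_comap_iff h, mem_comap_iff h, mem_comap_iff h]
      exact mem_inter

end CopenSection

/-- The contravariant functor taking a skew Boolean space to the algebra of its copen sections,
and a morphism `(g, h)` to `S ↦ g⁻¹(S)`. -/
def copenSections : SkewBooleanSpace.{u}ᵒᵖ ⥤ RightSkewAlg.{u} where
  obj X := ⟨CopenSection X.unop, CopenSection.isRightHanded⟩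
  map f := CopenSection.comapHom f.unop
  map_id _ := SkewAlgHom.ext (funext fun _ => CopenSection.ext (preimage_pfun_id _))
  map_comp _ _ := SkewAlgHom.ext (funext fun _ => CopenSection.ext (PFun.preimage_comp _ _ _))

/-! ### From algebras to spaces: the skew spectrum -/

section Spectrum

variable {A : Type u} [SkewBooleanInterAlgebra A]

/-- Ideals: subsets that are lower sets for the natural preorder and closed under finite joins. -/
structure IsSkewIdeal (I : Set A) : Prop where
  lower : ∀ x y, NatPreLE x y → y ∈ I → x ∈ I
  zero_mem : 0 ∈ I
  sup_mem : ∀ x y, x ∈ I → y ∈ I → x ⊔ y ∈ I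

/-- Congruence relations, with respect to all the operations. -/
structure IsSkewCongruence (r : A → A → Prop) : Prop where
  equivalence : Equivalence r
  inf : ∀ x x' y y', r x x' → r y y' → r (x ⊓ y) (x' ⊓ y')
  sup : ∀ x x' y y', r x x' → r y y' → r (x ⊔ y) (x' ⊔ y')
  sdiff : ∀ x x' y y', r x x' → r y y' → r (x \ y) (x' \ y')
  inter : ∀ x x' y y', r x x' → r y y' →
    r (SkewBooleanInterAlgebra.inter x y) (SkewBooleanInterAlgebra.inter x' y')

/-- `θ_I`, the least congruence relation whose zero-class contains `I`. -/
def theta (I : Set A) (x y : A) : Prop :=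
  ∀ r : A → A → Prop, IsSkewCongruence r → (∀ a ∈ I, r a 0) → r x y

variable (A) in
/-- The points of the spectrum: prime ideals. -/
@[ext]
structure PrimeSpec where
  carrier : Set A
  isIdeal : IsSkewIdeal carrier
  ne_univ : carrier ≠ Set.univ
  prime : ∀ x y, x ⊓ y ∈ carrier → x ∈ carrier ∨ y ∈ carrier

/-- The basic open set `N_a` of the prime ideals that do not contain `a`. -/
def baseN (a : A) : Set (PrimeSpec A) := {P | a ∉ P.carrier}

instance : TopologicalSpace (PrimeSpec A) :=
  TopologicalSpace.generateFrom (Set.range (baseN (A := A)))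

variable (A) in
/-- The points of the skew spectrum: pairs of a prime ideal `P` and a non-zero equivalence
class of `θ_P`, that is, the class of some `t ∉ P`. -/
@[ext]
structure SkewSpec where
  ideal : PrimeSpec A
  cls : Set A
  isClass : ∃ t, t ∉ ideal.carrier ∧ cls = {x | theta ideal.carrier t x}

/-- The point `(P, [t])` of the skew spectrum. -/
def SkewSpec.point (P : PrimeSpec A) (t : A) (ht : t ∉ P.carrier) : SkewSpec A :=
  ⟨P, {x | theta P.carrier t x}, t, ht, rfl⟩

/-- The basic open set `M_a` of the points `(P, [a])` where `a ∉ P`. -/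
def baseM (a : A) : Set (SkewSpec A) :=
  {y | ∃ (P : PrimeSpec A) (ha : a ∉ P.carrier), y = SkewSpec.point P a ha}

instance : TopologicalSpace (SkewSpec A) :=
  TopologicalSpace.generateFrom (Set.range (baseM (A := A)))

variable (A) in
/-- The projection `q_A` from the skew spectrum to the spectrum. -/
def specProj (y : SkewSpec A) : PrimeSpec A := y.ideal

variable {A' : Type u} [SkewBooleanInterAlgebra A']

/-- The preimage of a prime ideal under a homomorphism, provided that it is not everything. -/
def PrimeSpec.comap (f : SkewAlgHom A A') (P : PrimeSpec A') (h : ∃ a, f a ∉ P.carrier) :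
    PrimeSpec A where
  carrier := {a | f a ∈ P.carrier}
  isIdeal :=
    { lower := fun x y hxy hy => P.isIdeal.lower (f x) (f y)
        (by rw [NatPreLE, ← f.map_inf, ← f.map_inf, hxy]) hy
      zero_mem := by
        rw [Set.mem_ofPred_eq, f.map_zero]
        exact P.isIdeal.zero_mem
      sup_mem := fun x y hx hy => by
        rw [Set.mem_ofPred_eq, f.map_sup]
        exact P.isIdeal.sup_mem _ _ hx hy }
  ne_univ := by
    obtain ⟨a, ha⟩ := h
    exact fun hu => ha (hu.symm ▸ Set.mem_univ a : a ∈ {a | f a ∈ P.carrier})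
  prime x y hxy := P.prime _ _ (by rwa [Set.mem_ofPred_eq, f.map_inf] at hxy)

/-- The partial map between spectra that takes prime ideals to their preimages, when these are
prime ideals. -/
def specDown (f : SkewAlgHom A A') : PrimeSpec A' →. PrimeSpec A :=
  fun P => ⟨∃ a, f a ∉ P.carrier, fun h => P.comap f h⟩

/-- The partial map between skew spectra that takes `(P, [f a])` to `(f⁻¹(P), [a])`, whenever
`f a ∉ P`, and is not defined on other points. -/
noncomputable def specUp (f : SkewAlgHom A A') : SkewSpec A' →. SkewSpec A :=
  fun y => ⟨∃ a, ∃ ha : f a ∉ y.ideal.carrier, y = SkewSpec.point y.ideal (f a) ha,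
    fun h => SkewSpec.point (y.ideal.comap f ⟨h.choose, h.choose_spec.choose⟩) h.choose
      h.choose_spec.choose⟩

end Spectrum

/-- The skew spectrum is a contravariant functor from right-handed skew Boolean algebras with
intersections to skew Boolean spaces: the spaces are skew Boolean, the induced partial maps are
well defined (independent of the choice of a representative `a`) and are morphisms, and they
respect identities and composition. -/
structure SkewSpectrumIsFunctorial : Prop where
  isSkewBoolean : ∀ A : RightSkewAlg.{u}, IsSkewBoolean (specProj A)
  up_point : ∀ (A A' : RightSkewAlg.{u}) (f : A ⟶ A') (P : PrimeSpec A') (a : A)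
    (ha : f.toFun a ∉ P.carrier),
    SkewSpec.point (P.comap f ⟨a, ha⟩) a ha ∈ specUp f (SkewSpec.point P (f.toFun a) ha)
  isMorphism : ∀ (A A' : RightSkewAlg.{u}) (f : A ⟶ A'),
    IsSkewBooleanMorphism (specProj A') (specProj A) (specUp f) (specDown f)
  up_id : ∀ A : RightSkewAlg.{u}, specUp (𝟙 A) = PFun.id (SkewSpec A)
  down_id : ∀ A : RightSkewAlg.{u}, specDown (𝟙 A) = PFun.id (PrimeSpec A)
  up_comp : ∀ (A A' A'' : RightSkewAlg.{u}) (f : A ⟶ A') (g : A' ⟶ A''),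
    specUp (f ≫ g) = (specUp f).comp (specUp g)
  down_comp : ∀ (A A' A'' : RightSkewAlg.{u}) (f : A ⟶ A') (g : A' ⟶ A''),
    specDown (f ≫ g) = (specDown f).comp (specDown g)

/-- The contravariant functor taking `A` to its skew spectrum `q_A`, and a homomorphism `f` to
the pair of partial maps induced on skew spectra and on spectra. -/
noncomputable def skewSpectrum (h : SkewSpectrumIsFunctorial.{u}) :
    RightSkewAlg.{u}ᵒᵖ ⥤ SkewBooleanSpace.{u} where
  obj A := ⟨SkewSpec A.unop, PrimeSpec A.unop, specProj A.unop, h.isSkewBoolean A.unop⟩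
  map f := ⟨specUp f.unop, specDown f.unop, h.isMorphism _ _ f.unop⟩
  map_id A := SkewBooleanSpace.Hom.ext (h.up_id A.unop) (h.down_id A.unop)
  map_comp f g := SkewBooleanSpace.Hom.ext (h.up_comp _ _ _ g.unop f.unop)
    (h.down_comp _ _ _ g.unop f.unop)

/-!
Let `A` be a right-handed skew Boolean algebra with intersections and `P` a prime ideal. Elements
`x` and `y` are congruent modulo `theta P.carrier` exactly when both lie in `P` or
`inter x y` does not (`PrimeSpec.theta_iff_germEq`). The point is that this relation is already a
congruence: transitivity holds because the elements below a given one commute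
(`SkewBooleanInterAlgebra.inf_comm_of_natLE`), and compatibility with the operations because, at
`P`, each operation returns one of its arguments or zero. So a point `y` of the skew spectrum is
determined by `y.ideal` and any one element of the class `y.cls`, the set `baseM a` consists of the
points with `a ∈ y.cls`, and membership in `y.cls` obeys the rules that define the operations on
copen sections.

With this description, the prime ideal theorem (`PrimeSpec.exists_ge_of_notMem`) makes the sets
`baseN a` and `baseM a` compact open bases of Hausdorff spaces, and the projection maps `baseM a`
homeomorphically onto `baseN a`. The value of `specUp f` at `y` is given by preimages under `f` of
`y.ideal` and `y.cls` (`mem_specUp`). Hence the preimage of `baseM a` is `baseM (f a)`, which yields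
continuity, properness, and functoriality.

The map `a ↦ baseM a` is a bijective homomorphism onto the copen sections of the skew spectrum
(`unitHom_bijective`): prime ideals separate elements, and a copen section is a finite union of
basic sets that join to a single one. Conversely, a point `y` of a skew Boolean space gives the set
of the copen sections containing it, and a base point `x` the prime ideal of the copen sections
whose support misses it. These maps are homeomorphisms onto the skew spectrum and the spectrum of
the algebra of copen sections (`SkewBooleanSpace.idealAt_surjective` is the compactness argument), and
they are natural.

Right-handedness is a property of an algebra; in the lemmas it is an instance argument
`Fact (IsRightHanded A)`.
-/

/-! ### Right-handed skew Boolean algebras -/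

section Algebra

variable {A : Type u} [SkewBooleanInterAlgebra A]

open SkewLattice SkewBooleanAlgebra SkewBooleanInterAlgebra

namespace SkewBooleanInterAlgebra

theorem zero_inf (x : A) : 0 ⊓ x = 0 := by
  simpa [zero_sup] using SkewLattice.inf_sup_self (0 : A) x

theorem inf_zero (x : A) : x ⊓ 0 = 0 := by
  simpa [sup_zero] using SkewLattice.sup_inf_self' (0 : A) x

theorem inter_self (x : A) : inter x x = x := by
  have hx : NatLE x x := ⟨SkewLattice.inf_idem x, SkewLattice.inf_idem x⟩
  have h1 := inter_le_left x x
  have h2 := le_inter x x x hx hx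
  exact h1.1.symm.trans h2.2

theorem natLE_antisymm {x y : A} (h : NatLE x y) (h' : NatLE y x) : x = y :=
  h.1.symm.trans h'.2

theorem inter_comm (x y : A) : inter x y = inter y x :=
  natLE_antisymm (le_inter _ _ _ (inter_le_right _ _) (inter_le_left _ _))
    (le_inter _ _ _ (inter_le_right _ _) (inter_le_left _ _))

theorem natLE_trans {x y z : A} (h : NatLE x y) (h' : NatLE y z) : NatLE x z :=
  ⟨by rw [← h.1, SkewLattice.inf_assoc, h'.1], by rw [← h.2, ← SkewLattice.inf_assoc, h'.2]⟩

variable [hA : Fact (IsRightHanded A)]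

theorem inf_inf_self (x y : A) : x ⊓ (y ⊓ x) = y ⊓ x := by
  rw [← SkewLattice.inf_assoc]; exact hA.out x y

theorem natPreLE_iff {x y : A} : NatPreLE x y ↔ y ⊓ x = x := by
  rw [NatPreLE, hA.out]

theorem natPreLE_trans {x y z : A} (h : NatPreLE x y) (h' : NatPreLE y z) : NatPreLE x z := by
  rw [natPreLE_iff] at *
  rw [← h, ← SkewLattice.inf_assoc, h']

theorem NatLE.natPreLE {x y : A} (h : NatLE x y) : NatPreLE x y := natPreLE_iff.2 h.2

theorem inf_natPreLE_left (x y : A) : NatPreLE (x ⊓ y) x := by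
  rw [natPreLE_iff, ← SkewLattice.inf_assoc, SkewLattice.inf_idem]

theorem inf_natLE_right (x y : A) : NatLE (x ⊓ y) y :=
  ⟨by rw [SkewLattice.inf_assoc, SkewLattice.inf_idem], inf_inf_self _ _⟩

theorem natLE_sup_left (x y : A) : NatLE x (x ⊔ y) :=
  ⟨SkewLattice.inf_sup_self x y, by
    rw [SkewBooleanAlgebra.inf_sup_right, SkewLattice.inf_idem, ← inf_inf_self,
      SkewLattice.sup_inf_self]⟩

theorem natPreLE_sup_right (x y : A) : NatPreLE y (x ⊔ y) :=
  natPreLE_iff.2 (SkewLattice.sup_inf_self' y x)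

theorem sup_natPreLE {x y z : A} (h : NatPreLE x z) (h' : NatPreLE y z) : NatPreLE (x ⊔ y) z := by
  rw [natPreLE_iff] at *
  rw [SkewBooleanAlgebra.inf_sup_left, h, h']

theorem inf_eq_zero_comm {x y : A} (h : x ⊓ y = 0) : y ⊓ x = 0 := by
  rw [← inf_inf_self, ← SkewLattice.inf_assoc, h, zero_inf]

theorem sdiff_sup_inf (x y : A) : (x \ y) ⊔ (y ⊓ x) = x := by
  have := SkewBooleanAlgebra.sdiff_sup x y
  rwa [hA.out] at this

theorem sdiff_natLE (x y : A) : NatLE (x \ y) x := by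
  have := natLE_sup_left (x \ y) (y ⊓ x)
  rwa [sdiff_sup_inf] at this

theorem inf_sdiff_self (x y : A) : y ⊓ (x \ y) = 0 := by
  have h := SkewBooleanAlgebra.sdiff_inf x y
  rw [hA.out] at h
  rw [← (sdiff_natLE x y).2, ← SkewLattice.inf_assoc]
  exact inf_eq_zero_comm h

theorem sdiff_inf_self (x y : A) : (x \ y) ⊓ y = 0 := inf_eq_zero_comm (inf_sdiff_self x y)

/-- The elements below a given one commute. Distributivity splits `v` along `x = (x \ u) ⊔ u`, and
the part of `u ⊓ v` that meets `x \ u` vanishes. -/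
theorem inf_comm_of_natLE {u v x : A} (hu : NatLE u x) (hv : NatLE v x) : u ⊓ v = v ⊓ u := by
  set w := x \ u with hw
  have hwu : w ⊔ u = x := by
    have := sdiff_sup_inf x u
    rwa [hu.1] at this
  have h0 : w ⊓ u = 0 := sdiff_inf_self x u
  have h1 : u ⊓ (v ⊓ w) = 0 := by
    rw [← SkewLattice.inf_idem (u ⊓ (v ⊓ w))]
    have : w ⊓ (u ⊓ (v ⊓ w)) = 0 := by rw [← SkewLattice.inf_assoc, h0, zero_inf]
    rw [SkewLattice.inf_assoc, SkewLattice.inf_assoc, this, inf_zero, inf_zero]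
  calc u ⊓ v = u ⊓ (v ⊓ (w ⊔ u)) := by rw [hwu, hv.1]
    _ = u ⊓ (v ⊓ w) ⊔ u ⊓ (v ⊓ u) := by
      rw [SkewBooleanAlgebra.inf_sup_left, SkewBooleanAlgebra.inf_sup_left]
    _ = v ⊓ u := by rw [h1, inf_inf_self, SkewBooleanAlgebra.zero_sup]

/-- Right-handed skew Boolean algebras are right normal bands under the meet: `x ⊓ z` and `y ⊓ z`
are both below `z`, hence commute. -/
theorem inf_left_comm (x y z : A) : x ⊓ (y ⊓ z) = y ⊓ (x ⊓ z) := by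
  have h := inf_comm_of_natLE (inf_natLE_right x z) (inf_natLE_right y z)
  rwa [SkewLattice.inf_assoc, inf_inf_self, SkewLattice.inf_assoc, inf_inf_self] at h

theorem inf_natLE_inf {x x' y y' : A} (h : NatLE x x') (h' : NatLE y y') :
    NatLE (x ⊓ y) (x' ⊓ y') := by
  constructor
  · rw [SkewLattice.inf_assoc, inf_left_comm y, h'.1, ← SkewLattice.inf_assoc, h.1]
  · rw [SkewLattice.inf_assoc, inf_left_comm y', h'.2, ← SkewLattice.inf_assoc, h.2]

end SkewBooleanInterAlgebra

/-! ### Prime ideals and the congruences they generate -/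

namespace PrimeSpec

theorem exists_notMem (P : PrimeSpec A) : ∃ t, t ∉ P.carrier :=
  (Set.ne_univ_iff_exists_notMem _).1 P.ne_univ

/-- Two elements are identified at `P` if both vanish there or their intersection does not. This
is an explicit description of the congruence `theta P.carrier`. -/
def GermEq (P : PrimeSpec A) (x y : A) : Prop :=
  (x ∈ P.carrier ∧ y ∈ P.carrier) ∨ inter x y ∉ P.carrier

theorem GermEq.symm {P : PrimeSpec A} {x y : A} (h : P.GermEq x y) : P.GermEq y x := by
  rw [GermEq, inter_comm, and_comm]
  exact h

variable [hA : Fact (IsRightHanded A)] (P : PrimeSpec A)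

theorem notMem_of_natLE {x y : A} (h : NatLE x y) (hx : x ∉ P.carrier) : y ∉ P.carrier :=
  fun hy => hx (P.isIdeal.lower x y h.natPreLE hy)

theorem inf_notMem {x y : A} : x ⊓ y ∉ P.carrier ↔ x ∉ P.carrier ∧ y ∉ P.carrier := by
  refine ⟨fun h => ⟨fun hx => h (P.isIdeal.lower _ _ (inf_natPreLE_left x y) hx),
    P.notMem_of_natLE (inf_natLE_right x y) h⟩, fun h hxy => ?_⟩
  exact (P.prime x y hxy).elim h.1 h.2

theorem sup_notMem {x y : A} : x ⊔ y ∉ P.carrier ↔ x ∉ P.carrier ∨ y ∉ P.carrier := by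
  constructor
  · intro h
    by_contra! hc
    exact h (P.isIdeal.sup_mem _ _ hc.1 hc.2)
  · rintro (h | h) hxy
    · exact P.notMem_of_natLE (natLE_sup_left x y) h hxy
    · exact h (P.isIdeal.lower _ _ (natPreLE_sup_right x y) hxy)

theorem sdiff_notMem {x y : A} : x \ y ∉ P.carrier ↔ x ∉ P.carrier ∧ y ∈ P.carrier := by
  constructor
  · refine fun h => ⟨P.notMem_of_natLE (sdiff_natLE x y) h, by_contra fun hy => ?_⟩
    exact (P.inf_notMem.2 ⟨h, hy⟩) ((sdiff_inf_self x y).symm ▸ P.isIdeal.zero_mem)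
  · rintro ⟨hx, hy⟩ h
    refine hx ?_
    rw [← sdiff_sup_inf x y]
    exact P.isIdeal.sup_mem _ _ h (P.isIdeal.lower _ _ (inf_natPreLE_left y x) hy)

theorem inter_notMem_iff {x y : A} :
    inter x y ∉ P.carrier ↔ ∃ m ∉ P.carrier, NatLE m x ∧ NatLE m y :=
  ⟨fun h => ⟨_, h, inter_le_left x y, inter_le_right x y⟩,
    fun ⟨_, hm, hx, hy⟩ => P.notMem_of_natLE (le_inter _ _ _ hx hy) hm⟩

variable {P}

theorem GermEq.of_natLE {x y : A} (h : NatLE x y) (hx : x ∉ P.carrier) : P.GermEq x y :=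
  Or.inr (P.inter_notMem_iff.2 ⟨x, hx, ⟨SkewLattice.inf_idem x, SkewLattice.inf_idem x⟩, h⟩)

theorem GermEq.mem_iff {x y : A} (h : P.GermEq x y) : x ∈ P.carrier ↔ y ∈ P.carrier := by
  rcases h with h | h
  · simp [h.1, h.2]
  · have h1 := P.notMem_of_natLE (inter_le_left x y) h
    have h2 := P.notMem_of_natLE (inter_le_right x y) h
    simp [h1, h2]

theorem GermEq.trans {x y z : A} (h : P.GermEq x y) (h' : P.GermEq y z) : P.GermEq x z := by
  by_cases hy : y ∈ P.carrier
  · exact Or.inl ⟨h.mem_iff.2 hy, h'.mem_iff.1 hy⟩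
  have h1 : inter x y ∉ P.carrier := h.resolve_left fun h => hy h.2
  have h2 : inter y z ∉ P.carrier := h'.resolve_left fun h => hy h.1
  refine Or.inr (P.inter_notMem_iff.2
    ⟨inter x y ⊓ inter y z, P.inf_notMem.2 ⟨h1, h2⟩, ?_, ?_⟩)
  · rw [inf_comm_of_natLE (inter_le_right x y) (inter_le_left y z)]
    exact natLE_trans (inf_natLE_right _ _) (inter_le_left x y)
  · exact natLE_trans (inf_natLE_right _ _) (inter_le_right y z)

theorem GermEq.inf {x x' y y' : A} (h : P.GermEq x x') (h' : P.GermEq y y') :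
    P.GermEq (x ⊓ y) (x' ⊓ y') := by
  have hx := h.mem_iff
  have hy := h'.mem_iff
  rcases h with h | h
  · refine Or.inl ⟨?_, ?_⟩ <;> by_contra hc <;> simp_all [inf_notMem]
  rcases h' with h' | h'
  · refine Or.inl ⟨?_, ?_⟩ <;> by_contra hc <;> simp_all [inf_notMem]
  · exact Or.inr (P.inter_notMem_iff.2 ⟨inter x x' ⊓ inter y y', P.inf_notMem.2 ⟨h, h'⟩,
      inf_natLE_inf (inter_le_left _ _) (inter_le_left _ _),
      inf_natLE_inf (inter_le_right _ _) (inter_le_right _ _)⟩)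

theorem GermEq.sup_left {x : A} (y : A) (hx : x ∉ P.carrier) : P.GermEq x (x ⊔ y) :=
  .of_natLE (natLE_sup_left x y) hx

theorem GermEq.sdiff_of_mem {x y : A} (hy : y ∈ P.carrier) : P.GermEq (x \ y) x := by
  by_cases hx : x ∈ P.carrier
  · exact Or.inl ⟨by by_contra hc; exact (P.sdiff_notMem.1 hc).1 hx, hx⟩
  · exact .of_natLE (sdiff_natLE x y) (P.sdiff_notMem.2 ⟨hx, hy⟩)

theorem GermEq.sup_right {x y : A} (hx : x ∈ P.carrier) : P.GermEq y (x ⊔ y) := by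
  by_cases hy : y ∈ P.carrier
  · exact Or.inl ⟨hy, P.isIdeal.sup_mem _ _ hx hy⟩
  refine (GermEq.sdiff_of_mem hx).symm.trans (.of_natLE ⟨?_, ?_⟩ (P.sdiff_notMem.2 ⟨hy, hx⟩))
  · rw [SkewBooleanAlgebra.inf_sup_left, sdiff_inf_self, (sdiff_natLE y x).1,
      SkewBooleanAlgebra.zero_sup]
  · rw [SkewBooleanAlgebra.inf_sup_right, inf_sdiff_self, (sdiff_natLE y x).2,
      SkewBooleanAlgebra.zero_sup]

theorem GermEq.inf_right {x y : A} (hx : x ∉ P.carrier) : P.GermEq (x ⊓ y) y := by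
  by_cases hy : y ∈ P.carrier
  · exact Or.inl ⟨by by_contra hc; exact (P.inf_notMem.1 hc).2 hy, hy⟩
  · exact .of_natLE (inf_natLE_right x y) (P.inf_notMem.2 ⟨hx, hy⟩)

theorem GermEq.sup {x x' y y' : A} (h : P.GermEq x x') (h' : P.GermEq y y') :
    P.GermEq (x ⊔ y) (x' ⊔ y') := by
  by_cases hx : x ∈ P.carrier
  · exact (GermEq.sup_right hx).symm.trans (h'.trans (.sup_right (h.mem_iff.1 hx)))
  · exact (GermEq.sup_left y hx).symm.trans (h.trans (.sup_left y' fun hc => hx (h.mem_iff.2 hc)))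

theorem GermEq.sdiff {x x' y y' : A} (h : P.GermEq x x') (h' : P.GermEq y y') :
    P.GermEq (x \ y) (x' \ y') := by
  by_cases hy : y ∈ P.carrier
  · exact (GermEq.sdiff_of_mem hy).trans (h.trans (GermEq.sdiff_of_mem (h'.mem_iff.1 hy)).symm)
  · have hy' := fun hc => hy (h'.mem_iff.2 hc)
    exact Or.inl ⟨by by_contra hc; exact hy (P.sdiff_notMem.1 hc).2,
      by by_contra hc; exact hy' (P.sdiff_notMem.1 hc).2⟩

theorem GermEq.inter_left {x y : A} (h : inter x y ∉ P.carrier) : P.GermEq (inter x y) x :=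
  .of_natLE (inter_le_left x y) h

theorem GermEq.inter {x x' y y' : A} (h : P.GermEq x x') (h' : P.GermEq y y') :
    P.GermEq (inter x y) (inter x' y') := by
  have key : ∀ {a a' b b' : A}, P.GermEq a a' → P.GermEq b b' →
      SkewBooleanInterAlgebra.inter a b ∉ P.carrier → SkewBooleanInterAlgebra.inter a' b' ∉ P.carrier := by
    intro a a' b b' ha hb hab
    have ha' : a ∉ P.carrier := P.notMem_of_natLE (inter_le_left a b) hab
    have := ha.symm.trans (GermEq.trans (Or.inr hab) hb)
    exact this.resolve_left fun hc => ha' (ha.mem_iff.2 hc.1)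
  by_cases hxy : SkewBooleanInterAlgebra.inter x y ∈ P.carrier
  · refine Or.inl ⟨hxy, by_contra fun hc => key h.symm h'.symm hc hxy⟩
  · exact (GermEq.inter_left hxy).trans (h.trans (GermEq.inter_left (key h h' hxy)).symm)

theorem isSkewCongruence_germEq (P : PrimeSpec A) : IsSkewCongruence P.GermEq where
  equivalence := ⟨fun x => by
    by_cases hx : x ∈ P.carrier
    · exact Or.inl ⟨hx, hx⟩
    · exact Or.inr (by rwa [inter_self]), GermEq.symm, GermEq.trans⟩
  inf _ _ _ _ := GermEq.inf
  sup _ _ _ _ := GermEq.sup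
  sdiff _ _ _ _ := GermEq.sdiff
  inter _ _ _ _ := GermEq.inter

/-- If `m = inter x y` is not in `P`, then `x` differs from `m` by `x \ m`, which lies in `P`;
hence `x` is congruent to `m`, and so is `y`. -/
theorem theta_iff_germEq {x y : A} : theta P.carrier x y ↔ P.GermEq x y := by
  constructor
  · exact fun h => h _ P.isSkewCongruence_germEq fun a ha => Or.inl ⟨ha, P.isIdeal.zero_mem⟩
  · rintro (⟨hx, hy⟩ | h) r hr h0
    · exact hr.equivalence.trans (h0 x hx) (hr.equivalence.symm (h0 y hy))
    · have key : ∀ {m z : A}, NatLE m z → m ∉ P.carrier → r z m := by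
        intro m z hmz hm
        have h1 : z \ m ∈ P.carrier := by
          by_contra hc
          exact hm (P.sdiff_notMem.1 hc).2
        have h2 := hr.sup _ _ _ _ (h0 _ h1) (hr.equivalence.refl (m ⊓ z))
        rwa [sdiff_sup_inf, SkewBooleanAlgebra.zero_sup, hmz.1] at h2
      exact hr.equivalence.trans (key (inter_le_left x y) h)
        (hr.equivalence.symm (key (inter_le_right x y) h))

variable {I : Set A}

/-- The prime ideal theorem: an ideal that is maximal among those avoiding `a` is prime. -/
theorem exists_ge_of_notMem (hI : IsSkewIdeal I) {a : A} (ha : a ∉ I) :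
    ∃ P : PrimeSpec A, I ⊆ P.carrier ∧ a ∉ P.carrier := by
  obtain ⟨M, hIM, hM⟩ := zorn_subset_nonempty {J : Set A | IsSkewIdeal J ∧ a ∉ J} (by
    rintro c hc hchain ⟨J₀, hJ₀⟩
    refine ⟨⋃₀ c, ⟨⟨?_, ⟨J₀, hJ₀, (hc hJ₀).1.zero_mem⟩, ?_⟩, ?_⟩, fun J => Set.subset_sUnion_of_mem⟩
    · rintro x y hxy ⟨J, hJ, hy⟩
      exact ⟨J, hJ, (hc hJ).1.lower x y hxy hy⟩
    · rintro x y ⟨J, hJ, hx⟩ ⟨K, hK, hy⟩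
      rcases hchain.total hJ hK with h | h
      · exact ⟨K, hK, (hc hK).1.sup_mem x y (h hx) hy⟩
      · exact ⟨J, hJ, (hc hJ).1.sup_mem x y hx (h hy)⟩
    · rintro ⟨J, hJ, h⟩
      exact (hc hJ).2 h) I ⟨hI, ha⟩
  obtain ⟨hMi, haM⟩ := hM.prop
  -- The ideal generated by `M` and `x ∉ M` contains `a`.
  have key : ∀ x ∉ M, ∃ i ∈ M, NatPreLE a (i ⊔ x) := by
    intro x hx
    by_contra! hc
    have hJ : {z | ∃ i ∈ M, NatPreLE z (i ⊔ x)} ∈ {J : Set A | IsSkewIdeal J ∧ a ∉ J} := by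
      refine ⟨⟨?_, ⟨0, hMi.zero_mem, ?_⟩, ?_⟩, fun ⟨i, hi, h⟩ => hc i hi h⟩
      · rintro z w hzw ⟨i, hi, h⟩
        exact ⟨i, hi, natPreLE_trans hzw h⟩
      · exact natPreLE_iff.2 (inf_zero _)
      · rintro z w ⟨i, hi, h⟩ ⟨j, hj, h'⟩
        have hi' : NatPreLE i (i ⊔ j ⊔ x) :=
          natPreLE_trans (natLE_sup_left i j).natPreLE (natLE_sup_left _ _).natPreLE
        have hj' : NatPreLE j (i ⊔ j ⊔ x) :=
          natPreLE_trans (natPreLE_sup_right i j) (natLE_sup_left _ _).natPreLE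
        exact ⟨i ⊔ j, hMi.sup_mem _ _ hi hj, sup_natPreLE
          (natPreLE_trans h (sup_natPreLE hi' (natPreLE_sup_right _ _)))
          (natPreLE_trans h' (sup_natPreLE hj' (natPreLE_sup_right _ _)))⟩
    refine hx (hM.le_of_ge hJ (fun i hi => ⟨i, hi, (natLE_sup_left i x).natPreLE⟩) ?_)
    exact ⟨0, hMi.zero_mem, natPreLE_sup_right _ _⟩
  refine ⟨⟨M, hMi, fun h => haM (h ▸ Set.mem_univ a), fun x y hxy => ?_⟩, hIM, haM⟩
  by_contra! hc
  obtain ⟨i, hi, h⟩ := key x hc.1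
  obtain ⟨j, hj, h'⟩ := key y hc.2
  rw [natPreLE_iff] at h h'
  refine haM (hMi.lower a ((i ⊔ x) ⊓ (j ⊔ y)) ?_ ?_)
  · rw [natPreLE_iff, SkewLattice.inf_assoc, h', h]
  · rw [SkewBooleanAlgebra.inf_sup_right, SkewBooleanAlgebra.inf_sup_left x]
    exact hMi.sup_mem _ _ (hMi.lower _ _ (inf_natPreLE_left _ _) hi) (hMi.sup_mem _ _
      (hMi.lower _ _ (inf_natLE_right _ _).natPreLE hj) hxy)

/-- Every nonzero element avoids some prime ideal. -/
theorem exists_notMem_of_ne_zero {a : A} (ha : a ≠ 0) : ∃ P : PrimeSpec A, a ∉ P.carrier := by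
  have h0 : IsSkewIdeal {(0 : A)} := by
    refine ⟨?_, rfl, ?_⟩
    · rintro x y hxy rfl
      rw [natPreLE_iff, zero_inf] at hxy
      exact hxy.symm
    · rintro x y rfl rfl
      exact SkewBooleanAlgebra.zero_sup 0
  obtain ⟨P, -, h⟩ := exists_ge_of_notMem h0 ha
  exact ⟨P, h⟩

end PrimeSpec

/-! ### Points of the skew spectrum -/

namespace SkewSpec

theorem exists_eq_point (y : SkewSpec A) : ∃ t ht, y = SkewSpec.point y.ideal t ht := by
  obtain ⟨t, ht, h⟩ := y.isClass
  exact ⟨t, ht, SkewSpec.ext rfl h⟩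

variable [hA : Fact (IsRightHanded A)]

theorem mem_cls_point {P : PrimeSpec A} {t : A} {ht : t ∉ P.carrier} {a : A} :
    a ∈ (SkewSpec.point P t ht).cls ↔ inter t a ∉ P.carrier := by
  change theta P.carrier t a ↔ _
  rw [PrimeSpec.theta_iff_germEq, PrimeSpec.GermEq]
  simp [ht]

theorem self_mem_cls_point {P : PrimeSpec A} {t : A} (ht : t ∉ P.carrier) :
    t ∈ (SkewSpec.point P t ht).cls := by
  rwa [mem_cls_point, inter_self]

theorem mem_cls_congr {y : SkewSpec A} {a b : A} (h : y.ideal.GermEq a b) :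
    a ∈ y.cls ↔ b ∈ y.cls := by
  obtain ⟨t, ht, hy⟩ := y.isClass
  rw [hy]
  change theta _ _ _ ↔ theta _ _ _
  rw [PrimeSpec.theta_iff_germEq, PrimeSpec.theta_iff_germEq]
  exact ⟨fun h' => h'.trans h, fun h' => h'.trans h.symm⟩

theorem notMem_ideal {y : SkewSpec A} {a : A} (h : a ∈ y.cls) : a ∉ y.ideal.carrier := by
  obtain ⟨t, ht, hy⟩ := y.exists_eq_point
  rw [hy, mem_cls_point] at h
  exact y.ideal.notMem_of_natLE (inter_le_right _ _) h

theorem inter_notMem_ideal {y : SkewSpec A} {a b : A} (ha : a ∈ y.cls) (hb : b ∈ y.cls) :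
    inter a b ∉ y.ideal.carrier := by
  obtain ⟨t, ht, hy⟩ := y.isClass
  rw [hy] at ha hb
  change theta _ _ _ at ha hb
  rw [PrimeSpec.theta_iff_germEq] at ha hb
  have := ha.symm.trans hb
  exact this.resolve_left fun hc => ht (ha.mem_iff.2 hc.1)

theorem eq_point {y : SkewSpec A} {a : A} (h : a ∈ y.cls) :
    y = SkewSpec.point y.ideal a (notMem_ideal h) := by
  refine SkewSpec.ext rfl (Set.ext fun b => ?_)
  rw [mem_cls_point]
  exact ⟨inter_notMem_ideal h, fun hb => (mem_cls_congr (Or.inr hb)).1 h⟩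

theorem mem_baseM {y : SkewSpec A} {a : A} : y ∈ baseM a ↔ a ∈ y.cls := by
  constructor
  · rintro ⟨P, ha, rfl⟩
    exact self_mem_cls_point ha
  · exact fun h => ⟨_, _, eq_point h⟩

theorem eq_of_mem_cls {y z : SkewSpec A} (h : y.ideal = z.ideal) {a : A} (hy : a ∈ y.cls)
    (hz : a ∈ z.cls) : y = z := by
  obtain ⟨P, C, _⟩ := y
  obtain ⟨Q, D, _⟩ := z
  obtain rfl : P = Q := h
  rw [eq_point hy, eq_point hz]

variable {y : SkewSpec A} {a b : A}

theorem exists_mem_cls (y : SkewSpec A) : ∃ a, a ∈ y.cls := by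
  obtain ⟨t, ht, hy⟩ := y.exists_eq_point
  exact ⟨t, by rw [hy]; exact self_mem_cls_point ht⟩

theorem zero_notMem_cls : (0 : A) ∉ y.cls :=
  fun h => notMem_ideal h y.ideal.isIdeal.zero_mem

theorem inf_mem_cls : a ⊓ b ∈ y.cls ↔ a ∉ y.ideal.carrier ∧ b ∈ y.cls := by
  by_cases ha : a ∈ y.ideal.carrier
  · simp only [ha, not_true_eq_false, false_and, iff_false]
    exact fun h => (y.ideal.inf_notMem.1 (notMem_ideal h)).1 ha
  · simp [ha, mem_cls_congr (PrimeSpec.GermEq.inf_right ha)]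

theorem sup_mem_cls : a ⊔ b ∈ y.cls ↔ a ∈ y.cls ∨ (b ∈ y.cls ∧ a ∈ y.ideal.carrier) := by
  by_cases ha : a ∈ y.ideal.carrier
  · have : a ∉ y.cls := fun h => notMem_ideal h ha
    simp [ha, this, ← mem_cls_congr (PrimeSpec.GermEq.sup_right ha)]
  · simp [ha, ← mem_cls_congr (PrimeSpec.GermEq.sup_left b ha)]

theorem sdiff_mem_cls : a \ b ∈ y.cls ↔ a ∈ y.cls ∧ b ∈ y.ideal.carrier := by
  by_cases hb : b ∈ y.ideal.carrier
  · simp [hb, mem_cls_congr (PrimeSpec.GermEq.sdiff_of_mem hb)]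
  · simp only [hb, and_false, iff_false]
    exact fun h => hb (y.ideal.sdiff_notMem.1 (notMem_ideal h)).2

theorem inter_mem_cls : inter a b ∈ y.cls ↔ a ∈ y.cls ∧ b ∈ y.cls := by
  constructor
  · intro h
    have h' := notMem_ideal h
    have h1 := (mem_cls_congr (PrimeSpec.GermEq.inter_left h')).1 h
    exact ⟨h1, (mem_cls_congr (Or.inr h')).1 h1⟩
  · rintro ⟨ha, hb⟩
    exact (mem_cls_congr (PrimeSpec.GermEq.inter_left (inter_notMem_ideal ha hb))).2 ha

end SkewSpec

end Algebra

/-! ### Boolean spaces and proper partial maps -/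

section Topology

open TopologicalSpace

theorem isBooleanSpace_of_isTopologicalBasis {X : Type u} [TopologicalSpace X] [T2Space X]
    {𝓑 : Set (Set X)} (h𝓑 : IsTopologicalBasis 𝓑) (hc : ∀ s ∈ 𝓑, IsCompact s) :
    IsBooleanSpace X where
  t2 := inferInstance
  locallyCompact := .of_hasBasis (fun x => h𝓑.nhds_hasBasis (a := x)) fun _ s hs => hc s hs.1
  zeroDimensional := h𝓑.of_isOpen_of_subset (fun _ hs => hs.isOpen)
    fun s hs => ⟨(hc s hs).isClosed, h𝓑.isOpen hs⟩

theorem IsBooleanSpace.exists_isCompact_isOpen {X : Type u} [TopologicalSpace X]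
    (hX : IsBooleanSpace X) {x : X} {U : Set X} (hU : IsOpen U) (hx : x ∈ U) :
    ∃ K, IsCompact K ∧ IsOpen K ∧ x ∈ K ∧ K ⊆ U := by
  have := hX.locallyCompact
  obtain ⟨L, hL, hxL, hLU⟩ := exists_compact_subset hU hx
  obtain ⟨K, hK, hxK, hKL⟩ := hX.zeroDimensional.exists_subset_of_mem_open hxL isOpen_interior
  exact ⟨K, hL.of_isClosed_subset hK.isClosed (hKL.trans interior_subset), hK.isOpen, hxK,
    hKL.trans (interior_subset.trans hLU)⟩

/-- Properness and continuity of a partial map can be tested on a basis. A compact set `K` is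
covered by finitely many basic sets, and its preimage is closed in the preimage of the cover. -/
theorem isProperPartial_of_isTopologicalBasis {X Y : Type u} {ι : Type*} [TopologicalSpace X]
    [TopologicalSpace Y] [T2Space Y] {b : ι → Set Y} (hb : IsTopologicalBasis (Set.range b))
    {f : X →. Y} (ho : ∀ i, IsOpen (f.preimage (b i)))
    (hc : ∀ i, IsCompact (f.preimage (b i))) : IsProperPartial f := by
  have ho' : ∀ s, IsOpen s → IsOpen (f.preimage s) := by
    intro s hs
    rw [isOpen_iff_forall_mem_open]
    rintro x ⟨y, hy, hxy⟩
    obtain ⟨_, ⟨i, rfl⟩, hi, his⟩ := hb.exists_subset_of_mem_open hy hs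
    exact ⟨_, f.preimage_mono his, ho i, y, hi, hxy⟩
  refine isProperPartial_of_preimage ho' fun K hK => ?_
  obtain ⟨t, ht⟩ := hK.elim_finite_subcover b (fun i => hb.isOpen ⟨i, rfl⟩) (by
    intro y _
    obtain ⟨_, ⟨i, rfl⟩, hi⟩ := hb.exists_subset_of_mem_open (Set.mem_univ y) isOpen_univ
    exact Set.mem_iUnion.2 ⟨i, hi.1⟩)
  have hL : IsCompact (⋃ i ∈ t, f.preimage (b i)) := t.isCompact_biUnion fun i _ => hc i
  convert hL.diff (ho' _ hK.isClosed.isOpen_compl) using 1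
  ext x
  constructor
  · rintro ⟨y, hy, hxy⟩
    obtain ⟨i, hi, hyi⟩ := Set.mem_iUnion₂.1 (ht hy)
    refine ⟨Set.mem_iUnion₂.2 ⟨i, hi, y, hyi, hxy⟩, ?_⟩
    rintro ⟨z, hz, hxz⟩
    exact hz (Part.mem_unique hxz hxy ▸ hy)
  · rintro ⟨hx, hx'⟩
    obtain ⟨i, -, y, -, hxy⟩ := Set.mem_iUnion₂.1 hx
    exact ⟨y, by_contra fun hy => hx' ⟨y, hy, hxy⟩, hxy⟩

end Topology

/-! ### The topology of the spectrum and of the skew spectrum -/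

section SpectrumTopology

open TopologicalSpace SkewBooleanInterAlgebra

variable {A : Type u} [SkewBooleanInterAlgebra A]

theorem isOpen_baseN (a : A) : IsOpen (baseN a) := isOpen_generateFrom_of_mem ⟨a, rfl⟩

theorem isOpen_baseM (a : A) : IsOpen (baseM a) := isOpen_generateFrom_of_mem ⟨a, rfl⟩

theorem mem_baseN {P : PrimeSpec A} {a : A} : P ∈ baseN a ↔ a ∉ P.carrier := Iff.rfl

variable [hA : Fact (IsRightHanded A)]

theorem isTopologicalBasis_baseN : IsTopologicalBasis (Set.range (baseN (A := A))) where
  exists_subset_inter := by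
    rintro _ ⟨a, rfl⟩ _ ⟨b, rfl⟩ P ⟨ha, hb⟩
    exact ⟨_, ⟨a ⊓ b, rfl⟩, P.inf_notMem.2 ⟨ha, hb⟩, fun Q hQ => Q.inf_notMem.1 hQ⟩
  sUnion_eq := Set.eq_univ_of_forall fun P => by
    obtain ⟨t, ht⟩ := P.exists_notMem
    exact ⟨_, ⟨t, rfl⟩, ht⟩
  eq_generateFrom := rfl

theorem isTopologicalBasis_baseM : IsTopologicalBasis (Set.range (baseM (A := A))) where
  exists_subset_inter := by
    rintro _ ⟨a, rfl⟩ _ ⟨b, rfl⟩ y ⟨ha, hb⟩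
    rw [SkewSpec.mem_baseM] at ha hb
    refine ⟨_, ⟨inter a b, rfl⟩, SkewSpec.mem_baseM.2 (SkewSpec.inter_mem_cls.2 ⟨ha, hb⟩), ?_⟩
    intro z hz
    rw [SkewSpec.mem_baseM, SkewSpec.inter_mem_cls] at hz
    exact ⟨SkewSpec.mem_baseM.2 hz.1, SkewSpec.mem_baseM.2 hz.2⟩
  sUnion_eq := Set.eq_univ_of_forall fun y => by
    obtain ⟨t, ht⟩ := y.exists_mem_cls
    exact ⟨_, ⟨t, rfl⟩, SkewSpec.mem_baseM.2 ht⟩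
  eq_generateFrom := rfl

/-- By Alexander's subbasis theorem it is enough to consider covers by basic sets. The elements
`b` for which `baseN b` is covered by finitely many members of the cover form an ideal; if it did
not contain `a`, a prime ideal containing it and avoiding `a` would not be covered. -/
theorem isCompact_baseN (a : A) : IsCompact (baseN a) := by
  refine isCompact_generateFrom rfl fun 𝓒 h𝓒 hcover => ?_
  have hI : IsSkewIdeal {b : A | ∃ 𝓠 ⊆ 𝓒, 𝓠.Finite ∧ baseN b ⊆ ⋃₀ 𝓠} := by
    refine ⟨?_, ⟨∅, Set.empty_subset _, Set.finite_empty, fun P hP => ?_⟩, ?_⟩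
    · rintro x y hxy ⟨𝓠, h1, h2, h3⟩
      exact ⟨𝓠, h1, h2, fun P hP => h3 fun hy => hP (P.isIdeal.lower x y hxy hy)⟩
    · exact (hP P.isIdeal.zero_mem).elim
    · rintro x y ⟨𝓠, h1, h2, h3⟩ ⟨𝓡, h4, h5, h6⟩
      refine ⟨𝓠 ∪ 𝓡, Set.union_subset h1 h4, h2.union h5, fun P hP => ?_⟩
      rw [Set.sUnion_union]
      exact (P.sup_notMem.1 hP).imp (fun h => h3 h) fun h => h6 h
  by_contra hc
  obtain ⟨P, hP, haP⟩ := PrimeSpec.exists_ge_of_notMem hI hc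
  obtain ⟨N, hN, hPN⟩ := hcover haP
  obtain ⟨b, rfl⟩ := h𝓒 hN
  exact hPN (hP ⟨{baseN b}, by simpa using hN, Set.finite_singleton _, by simp⟩)

instance : T2Space (PrimeSpec A) := by
  -- If `a` lies in `P` and not in `Q`, then `baseN (t \ a)` and `baseN a` separate `P` from `Q`.
  have key : ∀ {P Q : PrimeSpec A} {a : A}, a ∈ P.carrier → a ∉ Q.carrier →
      ∃ u v : Set (PrimeSpec A), IsOpen u ∧ IsOpen v ∧ P ∈ u ∧ Q ∈ v ∧ Disjoint u v := by
    intro P Q a haP haQ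
    obtain ⟨t, ht⟩ := P.exists_notMem
    refine ⟨baseN (t \ a), baseN a, isOpen_baseN _, isOpen_baseN _, P.sdiff_notMem.2 ⟨ht, haP⟩,
      haQ, Set.disjoint_left.2 fun R hR hR' => hR' (R.sdiff_notMem.1 hR).2⟩
  refine ⟨fun P Q hPQ => ?_⟩
  obtain ⟨a, ha⟩ : ∃ a, ¬(a ∈ P.carrier ↔ a ∈ Q.carrier) := by
    by_contra! hc
    exact hPQ (PrimeSpec.ext (Set.ext hc))
  by_cases haP : a ∈ P.carrier
  · exact key haP fun haQ => ha (iff_of_true haP haQ)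
  · have haQ : a ∈ Q.carrier := by_contra fun haQ => ha (iff_of_false haP haQ)
    obtain ⟨u, v, hu, hv, hQ, hP, h⟩ := key haQ haP
    exact ⟨v, u, hv, hu, hP, hQ, h.symm⟩

variable (A) in
theorem isBooleanSpace_primeSpec : IsBooleanSpace (PrimeSpec A) :=
  isBooleanSpace_of_isTopologicalBasis isTopologicalBasis_baseN
    (by rintro _ ⟨a, rfl⟩; exact isCompact_baseN a)

variable (A) in
theorem continuous_specProj : Continuous (specProj A) := by
  refine continuous_generateFrom_iff.2 ?_
  rintro _ ⟨a, rfl⟩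
  have h : specProj A ⁻¹' baseN a = ⋃ t : A, baseM (a ⊓ t) := by
    ext y
    simp only [Set.mem_preimage, Set.mem_iUnion, SkewSpec.mem_baseM, SkewSpec.inf_mem_cls]
    exact ⟨fun h => y.exists_mem_cls.imp fun t ht => ⟨h, ht⟩, fun ⟨t, h, _⟩ => h⟩
  rw [h]
  exact isOpen_iUnion fun t => isOpen_baseM _

theorem image_specProj_baseM (a : A) : specProj A '' baseM a = baseN a := by
  ext P
  constructor
  · rintro ⟨y, hy, rfl⟩
    exact SkewSpec.notMem_ideal (SkewSpec.mem_baseM.1 hy)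
  · intro h
    exact ⟨SkewSpec.point P a h, ⟨P, h, rfl⟩, rfl⟩

variable (A) in
theorem isOpenMap_specProj : IsOpenMap (specProj A) := by
  refine isTopologicalBasis_baseM.isOpenMap_iff.2 ?_
  rintro _ ⟨a, rfl⟩
  rw [image_specProj_baseM]
  exact isOpen_baseN a

theorem injOn_specProj_baseM (a : A) : Set.InjOn (specProj A) (baseM a) :=
  fun _ hy _ hz h => SkewSpec.eq_of_mem_cls h (SkewSpec.mem_baseM.1 hy) (SkewSpec.mem_baseM.1 hz)

theorem isOpenEmbedding_domRestrict_baseM (a : A) :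
    Topology.IsOpenEmbedding ((baseM a).domRestrict (specProj A)) :=
  .of_continuous_injective_isOpenMap ((continuous_specProj A).comp continuous_subtype_val)
    (Set.injOn_iff_injective.1 (injOn_specProj_baseM a))
    ((isOpenMap_specProj A).comp (isOpen_baseM a).isOpenMap_subtype_val)

theorem isCompact_baseM (a : A) : IsCompact (baseM a) := by
  rw [isCompact_iff_isCompact_univ, (isOpenEmbedding_domRestrict_baseM a).isInducing.isCompact_iff]
  convert isCompact_baseN a using 1
  rw [← image_specProj_baseM, Set.image_univ, Set.range_domRestrict]

instance : T2Space (SkewSpec A) := by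
  refine ⟨fun y z hyz => ?_⟩
  by_cases h : specProj A y = specProj A z
  -- Distinct germs over one prime ideal: cutting `inter a b` out of representatives `a`, `b`
  -- makes their basic sets disjoint.
  · obtain ⟨a, ha⟩ := y.exists_mem_cls
    obtain ⟨b, hb⟩ := z.exists_mem_cls
    have hab : inter a b ∈ y.ideal.carrier := by
      by_contra hc
      have hby := (SkewSpec.mem_cls_congr (Or.inr hc)).1 ha
      exact hyz (SkewSpec.eq_of_mem_cls h hby hb)
    have hab' : inter a b ∈ z.ideal.carrier := by
      rwa [show y.ideal = z.ideal from h] at hab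
    refine ⟨baseM (a \ inter a b), baseM (b \ inter a b), isOpen_baseM _, isOpen_baseM _,
      SkewSpec.mem_baseM.2 (SkewSpec.sdiff_mem_cls.2 ⟨ha, hab⟩),
      SkewSpec.mem_baseM.2 (SkewSpec.sdiff_mem_cls.2 ⟨hb, hab'⟩),
      Set.disjoint_left.2 fun w hw hw' => ?_⟩
    rw [SkewSpec.mem_baseM, SkewSpec.sdiff_mem_cls] at hw hw'
    exact SkewSpec.inter_notMem_ideal hw.1 hw'.1 hw.2
  · obtain ⟨u, v, hu, hv, hy, hz, huv⟩ := t2_separation h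
    exact ⟨_, _, hu.preimage (continuous_specProj A), hv.preimage (continuous_specProj A), hy, hz,
      huv.preimage _⟩

variable (A) in
theorem isSkewBoolean_specProj : IsSkewBoolean (specProj A) where
  total := isBooleanSpace_of_isTopologicalBasis isTopologicalBasis_baseM
    (by rintro _ ⟨a, rfl⟩; exact isCompact_baseM a)
  base := isBooleanSpace_primeSpec A
  surjective P := by
    obtain ⟨t, ht⟩ := P.exists_notMem
    exact ⟨SkewSpec.point P t ht, rfl⟩
  etale := isLocalHomeomorph_iff_isOpenEmbedding_restrict.2 fun y => by
    obtain ⟨a, ha⟩ := y.exists_mem_cls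
    exact ⟨baseM a, (isOpen_baseM a).mem_nhds (SkewSpec.mem_baseM.2 ha),
      isOpenEmbedding_domRestrict_baseM a⟩

end SpectrumTopology

/-! ### Functoriality of the skew spectrum -/

section Functoriality

variable {A A' : Type u} [SkewBooleanInterAlgebra A] [SkewBooleanInterAlgebra A']

theorem mem_specDown {f : SkewAlgHom A A'} {P : PrimeSpec A'} {Q : PrimeSpec A} :
    Q ∈ specDown f P ↔ Q.carrier = {a | f a ∈ P.carrier} := by
  constructor
  · rintro ⟨h, rfl⟩
    rfl
  · intro h
    obtain ⟨a, ha⟩ := Q.exists_notMem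
    rw [h] at ha
    exact ⟨⟨a, ha⟩, PrimeSpec.ext h.symm⟩

theorem preimage_specDown_baseN (f : SkewAlgHom A A') (a : A) :
    (specDown f).preimage (baseN a) = baseN (f a) := by
  ext P
  constructor
  · rintro ⟨Q, hQ, hPQ⟩
    rwa [mem_baseN, mem_specDown.1 hPQ] at hQ
  · intro h
    exact ⟨P.comap f ⟨a, h⟩, h, ⟨a, h⟩, rfl⟩

variable [hA : Fact (IsRightHanded A)] [hA' : Fact (IsRightHanded A')]

open SkewBooleanInterAlgebra in
/-- If `y` is the class of `f a`, then the class of `a` at the preimage of `y.ideal` is the preimage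
of `y.cls`. -/
theorem cls_point_comap {f : SkewAlgHom A A'} {y : SkewSpec A'} {a : A} (h : f a ∈ y.cls)
    (h' : ∃ a, f a ∉ y.ideal.carrier) (ha : a ∉ (y.ideal.comap f h').carrier) :
    (SkewSpec.point (y.ideal.comap f h') a ha).cls = {b | f b ∈ y.cls} := by
  ext b
  rw [SkewSpec.mem_cls_point]
  change f (inter a b) ∉ y.ideal.carrier ↔ f b ∈ y.cls
  rw [f.map_inter]
  exact ⟨fun hb => (SkewSpec.mem_cls_congr (Or.inr hb)).1 h, SkewSpec.inter_notMem_ideal h⟩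

/-- The description of `specUp` without representatives: both components of the value are
preimages under `f`. In particular the choice of a representative does not matter. -/
theorem mem_specUp {f : SkewAlgHom A A'} {y : SkewSpec A'} {z : SkewSpec A} :
    z ∈ specUp f y ↔ z.ideal.carrier = {a | f a ∈ y.ideal.carrier} ∧
      z.cls = {a | f a ∈ y.cls} := by
  constructor
  · rintro ⟨h, rfl⟩
    exact ⟨rfl, cls_point_comap (SkewSpec.mem_baseM.1 ⟨_, h.choose_spec⟩) _ h.choose_spec.choose⟩
  · rintro ⟨h1, h2⟩
    obtain ⟨a, ha⟩ := z.exists_mem_cls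
    rw [h2] at ha
    have h : ∃ a, ∃ ha : f a ∉ y.ideal.carrier, y = SkewSpec.point y.ideal (f a) ha :=
      ⟨a, _, SkewSpec.eq_point ha⟩
    refine ⟨h, SkewSpec.ext (PrimeSpec.ext h1.symm) ?_⟩
    rw [h2]
    exact cls_point_comap (SkewSpec.mem_baseM.1 ⟨_, h.choose_spec⟩) _ h.choose_spec.choose

theorem exists_mem_specUp {f : SkewAlgHom A A'} {y : SkewSpec A'} {a : A} (h : f a ∈ y.cls) :
    ∃ z, z ∈ specUp f y :=
  ⟨SkewSpec.point (y.ideal.comap f ⟨a, SkewSpec.notMem_ideal h⟩) a (SkewSpec.notMem_ideal h),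
    mem_specUp.2 ⟨rfl, cls_point_comap h _ _⟩⟩

theorem preimage_specUp_baseM (f : SkewAlgHom A A') (a : A) :
    (specUp f).preimage (baseM a) = baseM (f a) := by
  ext y
  rw [SkewSpec.mem_baseM]
  constructor
  · rintro ⟨z, hz, hyz⟩
    rwa [SkewSpec.mem_baseM, (mem_specUp.1 hyz).2] at hz
  · intro h
    obtain ⟨z, hz⟩ := exists_mem_specUp h
    refine ⟨z, ?_, hz⟩
    rw [SkewSpec.mem_baseM, (mem_specUp.1 hz).2]
    exact h

theorem isSkewBooleanMorphism_spec (f : SkewAlgHom A A') :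
    IsSkewBooleanMorphism (specProj A') (specProj A) (specUp f) (specDown f) where
  top := isProperPartial_of_isTopologicalBasis isTopologicalBasis_baseM
    (fun a => by rw [preimage_specUp_baseM]; exact isOpen_baseM _)
    (fun a => by rw [preimage_specUp_baseM]; exact isCompact_baseM _)
  bot := isProperPartial_of_isTopologicalBasis isTopologicalBasis_baseN
    (fun a => by rw [preimage_specDown_baseN]; exact isOpen_baseN _)
    (fun a => by rw [preimage_specDown_baseN]; exact isCompact_baseN _)
  comm y z h := mem_specDown.2 (mem_specUp.1 h).1
  fiber := by
    rintro P _ hPQ z rfl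
    have hQ := mem_specDown.1 hPQ
    obtain ⟨a, ha⟩ := z.exists_mem_cls
    have ha' : f a ∉ P.carrier := fun h => SkewSpec.notMem_ideal ha (hQ.symm ▸ h)
    have hfa := SkewSpec.self_mem_cls_point ha'
    obtain ⟨w, hw⟩ := exists_mem_specUp hfa
    obtain ⟨hw1, hw2⟩ := mem_specUp.1 hw
    have hwz : w = z := SkewSpec.eq_of_mem_cls (PrimeSpec.ext (hw1.trans hQ.symm))
      (hw2.symm ▸ hfa) ha
    refine ⟨SkewSpec.point P (f a) ha', ⟨rfl, hwz ▸ hw⟩, ?_⟩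
    rintro y ⟨rfl, hy⟩
    rw [(mem_specUp.1 hy).2] at ha
    exact SkewSpec.eq_of_mem_cls rfl ha hfa

end Functoriality

instance (A : RightSkewAlg.{u}) : Fact (IsRightHanded A) := ⟨A.rightHanded⟩

theorem skewSpectrumIsFunctorial : SkewSpectrumIsFunctorial.{u} where
  isSkewBoolean A := isSkewBoolean_specProj A
  up_point A A' f P a ha := mem_specUp.2
    ⟨rfl, cls_point_comap (y := SkewSpec.point P _ ha) (SkewSpec.self_mem_cls_point ha) _ _⟩
  isMorphism A A' f := isSkewBooleanMorphism_spec f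
  up_id A := PFun.ext fun y z => by
    rw [mem_specUp]
    exact ⟨fun h => Part.mem_some_iff.2 (SkewSpec.ext (PrimeSpec.ext h.1) h.2),
      fun h => by obtain rfl := Part.mem_some_iff.1 h; exact ⟨rfl, rfl⟩⟩
  down_id A := PFun.ext fun P Q => by
    rw [mem_specDown]
    exact ⟨fun h => Part.mem_some_iff.2 (PrimeSpec.ext h),
      fun h => by obtain rfl := Part.mem_some_iff.1 h; rfl⟩
  up_comp A A' A'' f g := PFun.ext fun y z => by
    rw [mem_pfun_comp, mem_specUp]
    constructor
    · rintro ⟨h1, h2⟩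
      obtain ⟨a, ha⟩ := z.exists_mem_cls
      rw [h2] at ha
      obtain ⟨w, hw⟩ := exists_mem_specUp (f := g) (y := y) (a := f.toFun a) ha
      refine ⟨w, hw, ?_⟩
      rw [mem_specUp, (mem_specUp.1 hw).1, (mem_specUp.1 hw).2]
      exact ⟨h1, h2⟩
    · rintro ⟨w, hw, hz⟩
      rw [mem_specUp, (mem_specUp.1 hw).1, (mem_specUp.1 hw).2] at hz
      exact hz
  down_comp A A' A'' f g := PFun.ext fun P Q => by
    rw [mem_pfun_comp, mem_specDown]
    constructor
    · intro h
      obtain ⟨a, ha⟩ := Q.exists_notMem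
      rw [h] at ha
      refine ⟨P.comap g ⟨f.toFun a, ha⟩, mem_specDown.2 rfl, mem_specDown.2 h⟩
    · rintro ⟨R, hR, hQ⟩
      rw [mem_specDown, mem_specDown.1 hR] at hQ
      exact hQ

/-! ### The unit: an algebra is isomorphic to the copen sections of its skew spectrum -/

section Unit

open SkewBooleanInterAlgebra

variable {A : Type u} [SkewBooleanInterAlgebra A]

section

variable [hA : Fact (IsRightHanded A)]

/-- If `a ≠ b`, then the part of `a` or of `b` outside `inter a b` is nonzero, and a prime ideal
avoiding it separates `baseM a` from `baseM b`. -/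
theorem baseM_injective : Function.Injective (baseM (A := A)) := by
  have key : ∀ {a b : A}, baseM a = baseM b → inter a b = a := by
    intro a b hab
    have h0 : a \ inter a b = 0 := by
      by_contra hc
      obtain ⟨P, hP⟩ := PrimeSpec.exists_notMem_of_ne_zero hc
      have hy := SkewSpec.self_mem_cls_point hP
      rw [SkewSpec.sdiff_mem_cls] at hy
      have hb := hy.1
      rw [← SkewSpec.mem_baseM, hab, SkewSpec.mem_baseM] at hb
      exact SkewSpec.inter_notMem_ideal hy.1 hb hy.2
    have h1 := sdiff_sup_inf a (inter a b)
    rwa [h0, SkewBooleanAlgebra.zero_sup, (inter_le_left a b).1] at h1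
  intro a b hab
  rw [← key hab, inter_comm, key hab.symm]

end

variable (A : RightSkewAlg.{u})

/-- The copen section `baseM a` of the skew spectrum. -/
def baseSection (a : A) :
    CopenSection ((skewSpectrum skewSpectrumIsFunctorial).obj (op A)) where
  carrier := baseM a
  isOpen := isOpen_baseM a
  isCompact := isCompact_baseM a
  injOn := injOn_specProj_baseM a

variable {A}

theorem mem_baseSection {a : A} {y : SkewSpec A} : y ∈ (baseSection A a).carrier ↔ a ∈ y.cls :=
  SkewSpec.mem_baseM

theorem support_baseSection {a : A} {P : PrimeSpec A} :
    P ∈ (baseSection A a).support ↔ a ∉ P.carrier :=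
  Set.ext_iff.1 (image_specProj_baseM a) P

variable (A)

/-- The homomorphism from `A` to the copen sections of its skew spectrum. -/
def unitHom : A ⟶ copenSections.obj (op ((skewSpectrum skewSpectrumIsFunctorial).obj (op A))) where
  toFun := baseSection A
  map_zero := CopenSection.ext_mem fun y =>
    ⟨fun h => SkewSpec.zero_notMem_cls (mem_baseSection.1 h), fun h => h.elim⟩
  map_inf a b := CopenSection.ext_mem fun y => by
    refine mem_baseSection.trans (SkewSpec.inf_mem_cls.trans ?_)
    exact (and_congr support_baseSection mem_baseSection).symm
  map_sup a b := CopenSection.ext_mem fun y => by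
    refine mem_baseSection.trans (SkewSpec.sup_mem_cls.trans ?_)
    exact (or_congr mem_baseSection (and_congr mem_baseSection
      ((not_congr support_baseSection).trans not_not))).symm
  map_sdiff a b := CopenSection.ext_mem fun y => by
    refine mem_baseSection.trans (SkewSpec.sdiff_mem_cls.trans ?_)
    exact (and_congr mem_baseSection ((not_congr support_baseSection).trans not_not)).symm
  map_inter a b := CopenSection.ext_mem fun y => by
    refine mem_baseSection.trans (SkewSpec.inter_mem_cls.trans ?_)
    exact (and_congr mem_baseSection mem_baseSection).symm

/-- Every copen section is some `baseM a`: by compactness it is a finite union of basic sets, and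
inside a set on which the projection is injective, `baseM a ∪ baseM b = baseM (a ⊔ b)`. -/
theorem unitHom_bijective : Function.Bijective (unitHom A).toFun := by
  constructor
  · exact fun a b h => baseM_injective (congrArg CopenSection.carrier h)
  · intro (S : CopenSection ((skewSpectrum skewSpectrumIsFunctorial).obj (op A)))
    have hS : ∀ y ∈ S.carrier, ∃ a : A, a ∈ SkewSpec.cls y ∧ baseM a ⊆ S.carrier := by
      intro y hy
      obtain ⟨_, ⟨a, rfl⟩, ha, haS⟩ :=
        isTopologicalBasis_baseM.exists_subset_of_mem_open hy S.isOpen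
      exact ⟨a, SkewSpec.mem_baseM.1 ha, haS⟩
    have hsup : ∀ a b : A, baseM a ⊆ S.carrier → baseM b ⊆ S.carrier →
        baseM (a ⊔ b) = baseM a ∪ baseM b := by
      intro a b ha hb
      ext y
      rw [Set.mem_union, SkewSpec.mem_baseM, SkewSpec.mem_baseM, SkewSpec.mem_baseM,
        SkewSpec.sup_mem_cls]
      refine ⟨fun h => h.imp_right And.left, ?_⟩
      rintro (h | h)
      · exact Or.inl h
      · by_cases hay : a ∈ y.ideal.carrier
        · exact Or.inr ⟨h, hay⟩
        · have haz := SkewSpec.self_mem_cls_point hay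
          have : y = SkewSpec.point y.ideal a hay :=
            S.injOn (hb (SkewSpec.mem_baseM.2 h)) (ha (SkewSpec.mem_baseM.2 haz)) rfl
          rw [← this] at haz
          exact Or.inl haz
    have : Nonempty {a : A // baseM a ⊆ S.carrier} :=
      ⟨0, fun y hy => (SkewSpec.zero_notMem_cls (SkewSpec.mem_baseM.1 hy)).elim⟩
    obtain ⟨⟨a, ha⟩, h⟩ := S.isCompact.elim_directed_cover
      (fun a : {a : A // baseM a ⊆ S.carrier} => baseM a.1) (fun a => isOpen_baseM _) (by
        intro y hy
        obtain ⟨a, ha, haS⟩ := hS y hy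
        exact Set.mem_iUnion.2 ⟨⟨a, haS⟩, SkewSpec.mem_baseM.2 ha⟩) (by
        rintro ⟨a, ha⟩ ⟨b, hb⟩
        have h := hsup a b ha hb
        exact ⟨⟨a ⊔ b, h.le.trans (Set.union_subset ha hb)⟩, Set.subset_union_left.trans h.ge,
          Set.subset_union_right.trans h.ge⟩)
    exact ⟨a, CopenSection.ext (Set.Subset.antisymm ha h)⟩

end Unit

/-- A bijective homomorphism is an isomorphism. -/
noncomputable def RightSkewAlg.isoOfBijective {A A' : RightSkewAlg.{u}} (f : A ⟶ A')
    (hf : Function.Bijective f.toFun) : A ≅ A' :=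
  let e := Equiv.ofBijective f.toFun hf
  have he : ∀ x, f.toFun (e.symm x) = x := e.apply_symm_apply
  { hom := f
    inv :=
      { toFun := e.symm
        map_zero := hf.1 (by rw [he, f.map_zero])
        map_inf := fun x y => hf.1 (by rw [f.map_inf, he, he, he])
        map_sup := fun x y => hf.1 (by rw [f.map_sup, he, he, he])
        map_sdiff := fun x y => hf.1 (by rw [f.map_sdiff, he, he, he])
        map_inter := fun x y => hf.1 (by rw [f.map_inter, he, he, he]) }
    hom_inv_id := SkewAlgHom.ext (funext e.symm_apply_apply)
    inv_hom_id := SkewAlgHom.ext (funext he) }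

/-- The natural isomorphism between an algebra and the copen sections of its skew spectrum. -/
noncomputable def unitIso :
    𝟭 RightSkewAlg.{u}ᵒᵖ ≅ skewSpectrum skewSpectrumIsFunctorial ⋙ copenSections.rightOp :=
  (NatIso.ofComponents
    (fun A => (RightSkewAlg.isoOfBijective (unitHom A.unop) (unitHom_bijective A.unop)).op)
    (fun f => Quiver.Hom.unop_inj (SkewAlgHom.ext (funext fun a =>
      CopenSection.ext (preimage_specUp_baseM f.unop a))))).symm

/-! ### The counit: a skew Boolean space is isomorphic to the skew spectrum of its copen sections -/

section Counit

open TopologicalSpace SkewBooleanInterAlgebra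

instance (X : SkewBooleanSpace.{u}) : Fact (IsRightHanded (CopenSection X)) :=
  ⟨CopenSection.isRightHanded⟩

namespace SkewBooleanSpace

theorem exists_copenSection (X : SkewBooleanSpace.{u}) {y : X.Total} {U : Set X.Total}
    (hU : IsOpen U) (hy : y ∈ U) : ∃ S : CopenSection X, y ∈ S.carrier ∧ S.carrier ⊆ U := by
  obtain ⟨e, hye, he⟩ := X.isSkewBoolean.etale y
  obtain ⟨K, hK, hKo, hyK, hKU⟩ :=
    X.isSkewBoolean.total.exists_isCompact_isOpen (hU.inter e.open_source) ⟨hy, hye⟩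
  refine ⟨⟨K, hKo, hK, ?_⟩, hyK, fun z hz => (hKU hz).1⟩
  rw [he]
  exact e.injOn.mono fun z hz => (hKU hz).2

theorem isTopologicalBasis_carrier (X : SkewBooleanSpace.{u}) :
    IsTopologicalBasis (Set.range (CopenSection.carrier (X := X))) := by
  refine isTopologicalBasis_of_isOpen_of_nhds ?_ fun y U hy hU => ?_
  · rintro _ ⟨S, rfl⟩
    exact S.isOpen
  · obtain ⟨S, hyS, hSU⟩ := X.exists_copenSection hU hy
    exact ⟨_, ⟨S, rfl⟩, hyS, hSU⟩

end SkewBooleanSpace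

namespace CopenSection

variable {X : SkewBooleanSpace.{u}}

theorem isOpen_support (S : CopenSection X) : IsOpen S.support :=
  X.isSkewBoolean.etale.isOpenMap _ S.isOpen

theorem isCompact_support (S : CopenSection X) : IsCompact S.support :=
  S.isCompact.image X.isSkewBoolean.etale.continuous

end CopenSection

namespace SkewBooleanSpace

theorem isTopologicalBasis_support (X : SkewBooleanSpace.{u}) :
    IsTopologicalBasis (Set.range (CopenSection.support (X := X))) := by
  refine isTopologicalBasis_of_isOpen_of_nhds ?_ fun x U hx hU => ?_
  · rintro _ ⟨S, rfl⟩
    exact S.isOpen_support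
  · obtain ⟨y, rfl⟩ := X.isSkewBoolean.surjective x
    obtain ⟨S, hyS, hSU⟩ :=
      X.exists_copenSection (hU.preimage X.isSkewBoolean.etale.continuous) hx
    exact ⟨_, ⟨S, rfl⟩, CopenSection.mem_support_of_mem hyS, Set.image_subset_iff.2 hSU⟩

variable (X : SkewBooleanSpace.{u})

/-- The prime ideal of the copen sections that miss the fiber over `x`. -/
def idealAt (x : X.Base) : PrimeSpec (CopenSection X) where
  carrier := {S | x ∉ S.support}
  isIdeal :=
    { lower := fun S R h hR hS => by
        rw [natPreLE_iff] at h
        rw [← h] at hS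
        exact hR (CopenSection.support_inf.1 hS).1
      zero_mem := by
        rintro ⟨y, hy, -⟩
        exact hy
      sup_mem := fun S R hS hR h => (CopenSection.support_sup.1 h).elim hS hR }
  ne_univ := by
    obtain ⟨y, rfl⟩ := X.isSkewBoolean.surjective x
    obtain ⟨S, hS, -⟩ := X.exists_copenSection isOpen_univ (Set.mem_univ y)
    intro h
    have : S ∈ {S : CopenSection X | X.proj y ∉ S.support} := h ▸ Set.mem_univ S
    exact this (CopenSection.mem_support_of_mem hS)
  prime S R h := by
    by_contra! hc
    exact h (CopenSection.support_inf.2 ⟨not_not.1 hc.1, not_not.1 hc.2⟩)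

variable {X}

theorem notMem_idealAt {x : X.Base} {S : CopenSection X} :
    S ∉ (X.idealAt x).carrier ↔ x ∈ S.support := not_not

theorem inter_notMem_idealAt {y : X.Total} {S R : CopenSection X} (hS : y ∈ S.carrier) :
    inter S R ∉ (X.idealAt (X.proj y)).carrier ↔ y ∈ R.carrier := by
  rw [notMem_idealAt]
  constructor
  · rintro ⟨z, hz, hzy⟩
    rw [← S.injOn hz.1 hS hzy]
    exact hz.2
  · exact fun hR => ⟨y, ⟨hS, hR⟩, rfl⟩

variable (X)

/-- The point of the skew spectrum formed by the copen sections that contain `y`. -/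
def germAt (y : X.Total) : SkewSpec (CopenSection X) where
  ideal := X.idealAt (X.proj y)
  cls := {S | y ∈ S.carrier}
  isClass := by
    obtain ⟨S, hS, -⟩ := X.exists_copenSection isOpen_univ (Set.mem_univ y)
    have hS' := notMem_idealAt.2 (CopenSection.mem_support_of_mem hS)
    refine ⟨S, hS', Set.ext fun R => ?_⟩
    exact (inter_notMem_idealAt hS).symm.trans (SkewSpec.mem_cls_point (ht := hS')).symm

variable {X}

theorem idealAt_injective : Function.Injective X.idealAt := by
  intro x x' h
  by_contra hne
  have := X.isSkewBoolean.base.t2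
  obtain ⟨_, ⟨S, rfl⟩, hx, hx'⟩ :=
    X.isTopologicalBasis_support.exists_subset_of_mem_open (Set.mem_compl_singleton_iff.2 hne)
      isOpen_compl_singleton
  rw [← notMem_idealAt, h, notMem_idealAt] at hx
  exact hx' hx rfl

/-- Fix `S` outside the prime ideal `P`. If each point of the support of `S` lay in the support
of a member of `P`, then by compactness `S` would lie in `P`. So some `x` in the support of `S`
is outside the support of every member of `P`, and then `P` is the ideal at `x`. -/
theorem idealAt_surjective : Function.Surjective X.idealAt := by
  intro P
  obtain ⟨S, hS⟩ := P.exists_notMem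
  obtain ⟨x, hxS, hx⟩ : ∃ x ∈ S.support, ∀ R ∈ P.carrier, x ∉ R.support := by
    by_contra! hc
    have : Nonempty P.carrier := ⟨⟨0, P.isIdeal.zero_mem⟩⟩
    obtain ⟨⟨R, hR⟩, h⟩ := S.isCompact_support.elim_directed_cover
      (fun R : P.carrier => R.1.support) (fun R => R.1.isOpen_support) (fun x hx => by
        obtain ⟨R, hR, hxR⟩ := hc x hx
        exact Set.mem_iUnion.2 ⟨⟨R, hR⟩, hxR⟩) (by
        rintro ⟨R, hR⟩ ⟨T, hT⟩
        exact ⟨⟨R ⊔ T, P.isIdeal.sup_mem _ _ hR hT⟩,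
          fun x hx => CopenSection.support_sup.2 (Or.inl hx),
          fun x hx => CopenSection.support_sup.2 (Or.inr hx)⟩)
    refine hS (P.isIdeal.lower S R (natPreLE_iff.2 (CopenSection.ext_mem fun y => ?_)) hR)
    exact ⟨fun hy => hy.2, fun hy => ⟨h (CopenSection.mem_support_of_mem hy), hy⟩⟩
  refine ⟨x, PrimeSpec.ext (Set.ext fun R => ⟨fun hR => ?_, hx R⟩)⟩
  by_contra hRP
  have h : S \ R ∈ P.carrier := by
    by_contra hc
    exact hRP (P.sdiff_notMem.1 hc).2
  exact hx _ h (CopenSection.support_sdiff.2 ⟨hxS, hR⟩)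

theorem germAt_injective : Function.Injective X.germAt := by
  intro y y' h
  by_contra hne
  have := X.isSkewBoolean.total.t2
  obtain ⟨S, hy, hy'⟩ :=
    X.exists_copenSection isOpen_compl_singleton (Set.mem_compl_singleton_iff.2 hne)
  have h' : S ∈ (X.germAt y).cls := hy
  rw [h] at h'
  exact hy' h' rfl

theorem germAt_surjective : Function.Surjective X.germAt := by
  intro z
  obtain ⟨S, hS⟩ := z.exists_mem_cls
  obtain ⟨x, hx⟩ := X.idealAt_surjective z.ideal
  have hxS := SkewSpec.notMem_ideal hS
  rw [← hx, notMem_idealAt] at hxS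
  obtain ⟨y, hy, rfl⟩ := hxS
  exact ⟨y, SkewSpec.eq_of_mem_cls hx hy hS⟩

theorem preimage_germAt_baseM (S : CopenSection X) : X.germAt ⁻¹' baseM S = S.carrier :=
  Set.ext fun _ => SkewSpec.mem_baseM

theorem preimage_idealAt_baseN (S : CopenSection X) : X.idealAt ⁻¹' baseN S = S.support :=
  Set.ext fun _ => notMem_idealAt

variable (X)

theorem isHomeomorph_germAt : IsHomeomorph X.germAt where
  continuous := continuous_generateFrom_iff.2 (by
    rintro _ ⟨S, rfl⟩
    rw [preimage_germAt_baseM]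
    exact S.isOpen)
  isOpenMap := X.isTopologicalBasis_carrier.isOpenMap_iff.2 (by
    rintro _ ⟨S, rfl⟩
    rw [← preimage_germAt_baseM, Set.image_preimage_eq _ germAt_surjective]
    exact isOpen_baseM S)
  bijective := ⟨germAt_injective, germAt_surjective⟩

theorem isHomeomorph_idealAt : IsHomeomorph X.idealAt where
  continuous := continuous_generateFrom_iff.2 (by
    rintro _ ⟨S, rfl⟩
    rw [preimage_idealAt_baseN]
    exact S.isOpen_support)
  isOpenMap := X.isTopologicalBasis_support.isOpenMap_iff.2 (by
    rintro _ ⟨S, rfl⟩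
    rw [← preimage_idealAt_baseN, Set.image_preimage_eq _ idealAt_surjective]
    exact isOpen_baseN S)
  bijective := ⟨idealAt_injective, idealAt_surjective⟩

end SkewBooleanSpace

theorem isProperPartial_homeomorph {X Y : Type u} [TopologicalSpace X] [TopologicalSpace Y]
    (e : X ≃ₜ Y) : IsProperPartial (e : X →. Y) :=
  isProperPartial_of_preimage
    (fun s hs => by rw [PFun.coe_preimage]; exact hs.preimage e.continuous)
    (fun K hK => by rw [PFun.coe_preimage]; exact e.isCompact_preimage.2 hK)

theorem isSkewBooleanMorphism_homeomorph {X Y : SkewBooleanSpace.{u}} {g : X.Total ≃ₜ Y.Total}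
    {h : X.Base ≃ₜ Y.Base} (hgh : ∀ y, Y.proj (g y) = h (X.proj y)) :
    IsSkewBooleanMorphism X.proj Y.proj (g : X.Total →. Y.Total) (h : X.Base →. Y.Base) where
  top := isProperPartial_homeomorph g
  bot := isProperPartial_homeomorph h
  comm y y' hy := by
    obtain rfl := Part.mem_some_iff.1 hy
    exact Part.mem_some_iff.2 (hgh y)
  fiber x x' hx y' hy' := by
    obtain rfl := Part.mem_some_iff.1 hx
    refine ⟨g.symm y', ⟨h.injective ?_, Part.mem_some_iff.2 (by simp)⟩, ?_⟩
    · rw [← hgh, g.apply_symm_apply, hy']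
    · rintro z ⟨-, hz⟩
      rw [Part.mem_some_iff.1 hz, g.symm_apply_apply]

/-- A pair of homeomorphisms that commutes with the projections is an isomorphism of skew Boolean
spaces. -/
def SkewBooleanSpace.isoOfHomeomorph {X Y : SkewBooleanSpace.{u}} (g : X.Total ≃ₜ Y.Total)
    (h : X.Base ≃ₜ Y.Base) (hgh : ∀ y, Y.proj (g y) = h (X.proj y)) : X ≅ Y where
  hom := ⟨g, h, isSkewBooleanMorphism_homeomorph hgh⟩
  inv := ⟨g.symm, h.symm, isSkewBooleanMorphism_homeomorph fun y => h.injective (by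
    rw [← hgh, g.apply_symm_apply, h.apply_symm_apply])⟩
  hom_inv_id := SkewBooleanSpace.Hom.ext
    (by
      change PFun.comp (g.symm : Y.Total →. X.Total) (g : X.Total →. Y.Total) = PFun.id _
      rw [← PFun.coe_comp, g.symm_comp_self, PFun.coe_id])
    (by
      change PFun.comp (h.symm : Y.Base →. X.Base) (h : X.Base →. Y.Base) = PFun.id _
      rw [← PFun.coe_comp, h.symm_comp_self, PFun.coe_id])
  inv_hom_id := SkewBooleanSpace.Hom.ext
    (by
      change PFun.comp (g : X.Total →. Y.Total) (g.symm : Y.Total →. X.Total) = PFun.id _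
      rw [← PFun.coe_comp, g.self_comp_symm, PFun.coe_id])
    (by
      change PFun.comp (h : X.Base →. Y.Base) (h.symm : Y.Base →. X.Base) = PFun.id _
      rw [← PFun.coe_comp, h.self_comp_symm, PFun.coe_id])

namespace SkewBooleanSpace

/-- The isomorphism between a skew Boolean space and the skew spectrum of its copen sections. -/
noncomputable def germIso (X : SkewBooleanSpace.{u}) :
    X ≅ (skewSpectrum skewSpectrumIsFunctorial).obj (copenSections.rightOp.obj X) :=
  isoOfHomeomorph (X.isHomeomorph_germAt.homeomorph (Y := SkewSpec (CopenSection X)))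
    (X.isHomeomorph_idealAt.homeomorph (Y := PrimeSpec (CopenSection X))) fun _ => rfl

variable {X Y : SkewBooleanSpace.{u}}

theorem mem_specUp_germAt {f : X ⟶ Y} {y : X.Total} {z : SkewSpec (CopenSection Y)} :
    z ∈ specUp (CopenSection.comapHom f) (X.germAt y) ↔ ∃ y' ∈ f.top y, z = Y.germAt y' := by
  have key : ∀ y' ∈ f.top y, Y.germAt y' ∈ specUp (CopenSection.comapHom f) (X.germAt y) :=
    fun y' hy' => mem_specUp.2 ⟨Set.ext fun S => not_congr (CopenSection.support_comap hy').symm,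
      Set.ext fun S => (CopenSection.mem_comap_iff hy').symm⟩
  constructor
  · intro hz
    obtain ⟨S, hS⟩ := z.exists_mem_cls
    rw [(mem_specUp.1 hz).2] at hS
    obtain ⟨y', -, hy'⟩ := CopenSection.mem_comap.1 hS
    exact ⟨y', hy', Part.mem_unique hz (key y' hy')⟩
  · rintro ⟨y', hy', rfl⟩
    exact key y' hy'

theorem mem_specDown_idealAt {f : X ⟶ Y} {x : X.Base} {Q : PrimeSpec (CopenSection Y)} :
    Q ∈ specDown (CopenSection.comapHom f) (X.idealAt x) ↔ ∃ x' ∈ f.bot x, Q = Y.idealAt x' := by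
  have key : ∀ y, ∀ y' ∈ f.top y,
      Y.idealAt (Y.proj y') ∈ specDown (CopenSection.comapHom f) (X.idealAt (X.proj y)) :=
    fun y y' hy' => mem_specDown.2
      (Set.ext fun S => not_congr (CopenSection.support_comap hy').symm)
  constructor
  · intro hQ
    obtain ⟨S, hS⟩ := Q.exists_notMem
    rw [mem_specDown.1 hQ] at hS
    obtain ⟨y, hy, rfl⟩ := notMem_idealAt.1 hS
    obtain ⟨y', -, hy'⟩ := CopenSection.mem_comap.1 hy
    exact ⟨_, f.isMorphism.comm y y' hy', Part.mem_unique hQ (key y y' hy')⟩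
  · rintro ⟨x', hx', rfl⟩
    obtain ⟨y', rfl⟩ := Y.isSkewBoolean.surjective x'
    obtain ⟨y, ⟨rfl, hy⟩, -⟩ := f.isMorphism.fiber x _ hx' y' rfl
    exact key y y' hy

theorem germIso_naturality (f : X ⟶ Y) :
    f ≫ Y.germIso.hom =
      X.germIso.hom ≫ (skewSpectrum skewSpectrumIsFunctorial).map (copenSections.rightOp.map f) := by
  refine SkewBooleanSpace.Hom.ext (PFun.ext fun y z => ?_) (PFun.ext fun x Q => ?_)
  · refine mem_pfun_comp.trans (Iff.trans ?_ mem_pfun_comp.symm)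
    refine Iff.trans (exists_congr fun y' => and_congr_right fun _ => Part.mem_some_iff)
      (mem_specUp_germAt.symm.trans ?_)
    exact ⟨fun h => ⟨_, Part.mem_some _, h⟩,
      fun ⟨w, hw, h⟩ => by obtain rfl := Part.mem_some_iff.1 hw; exact h⟩
  · refine mem_pfun_comp.trans (Iff.trans ?_ mem_pfun_comp.symm)
    refine Iff.trans (exists_congr fun x' => and_congr_right fun _ => Part.mem_some_iff)
      (mem_specDown_idealAt.symm.trans ?_)
    exact ⟨fun h => ⟨_, Part.mem_some _, h⟩,
      fun ⟨w, hw, h⟩ => by obtain rfl := Part.mem_some_iff.1 hw; exact h⟩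

end SkewBooleanSpace

/-- The natural isomorphism between the skew spectrum of the copen sections of a skew Boolean
space and the space itself. -/
noncomputable def counitIso :
    copenSections.rightOp ⋙ skewSpectrum skewSpectrumIsFunctorial ≅ 𝟭 SkewBooleanSpace.{u} :=
  (NatIso.ofComponents SkewBooleanSpace.germIso SkewBooleanSpace.germIso_naturality).symm

end Counit

theorem mainTheorem1 :
    ∃ h : SkewSpectrumIsFunctorial.{u},
      ∃ e : RightSkewAlg.{u}ᵒᵖ ≌ SkewBooleanSpace.{u},
        e.functor = skewSpectrum h ∧ e.inverse = copenSections.rightOp :=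
  ⟨skewSpectrumIsFunctorial, .mk _ _ unitIso counitIso, rfl, rfl⟩
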